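/- Let $d\ge 1$, let $|x|=\sum_{i}|x_i|$ on $\mathbb R^d$, let $\mathcal C=\{x\in\mathbb R^d: x_i\ge 0 \text{ for all } i\}$ and $\mathbb X=\{x\in\mathcal C:|x|=1\}$. Let $S$ be the semigroup of $d\times d$ matrices with non-negative entries each of whose columns contains a positive entry, and $\mathring S\subset S$ the set of matrices with all entries positive. For $g\in S$, $x\in\mathbb X$ put $g\cdot x=gx/|gx|\in\mathbb X$, $\rho(g,x)=\log|gx|$, $v(g)=\min_j\sum_i g(i,j)$, $|g|=\max_j\sum_i g(i,j)$ and $N(g)=\max(1/v(g),|g|)$. Let $(g_n)_{n\ge 0}$ be i.i.d. $S$-valued random matrices with law $\mu$ on a probability space, let $\mu^{*n}$ be the law of $g_n\cdots g_1$, and assume: - **P1.** There is $\delta_0>0$ with $\int_S N(g)^{\delta_0}\,\mu(dg)<\infty$. - **P2.** There is no affine subspace $A$ of $\mathbb R^d$ such that $A\cap\mathcal C$ contains a non-zero vector, is bounded, and satisfies $g(A\cap\mathcal C)\subset A\cap\mathcal C$ for every $g$ in the support of $\mu$. - **P3.** There is $n_0\ge 1$ with $\mu^{*n_0}(\mathring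 S)>0$. - **P4.** The upper Lyapunov exponent $\gamma_\mu=\lim_{n\to\infty}\frac1n\int_S\log|g|\,\mu^{*n}(dg)$ is equal to $0$. - **P5.** There is $\delta>0$ with $\mu\{g\in S:\ \log|gx|\ge\delta \text{ for all } x\in\mathbb X\}>0$. For $x\in\mathbb X$ let $X_0=x$ and $X_n=(g_n\cdots g_1)\cdot x$ for $n\ge1$, let $a_k=\rho(g_k,X_{k-1})$ for $k\ge 1$ and $a_0=\rho(\mathrm{Id},x)=0$, and write $\mathrm{Var}_{\mathbb P_x}$ for the variance when the chain starts at $x$. **Proposition 5.3 (condition C3).** There is $\sigma>0$ such that all the sums $\sum_{k=m}^{m+n-1}a_k$ ($x\in\mathbb X$, $m,n\ge 0$) are square integrable and the following hold. 1. There is a constant $C>0$ such that for every $\gamma>0$, every $x\in\mathbb X$ and every $n\ge1$, $$\sup_{m\ge 0}\left|\frac1n\,\mathrm{Var}_{\mathbb P_x}\Bigl(\sum_{k=m}^{m+n-1}a_k\Bigr)-\sigma^2\right|\le C\,n^{-1+\gamma}.$$ 2. More precisely, there is a constant $C>0$ such that for every $x\in\mathbb X$ and every $n\ge 1$, $$\sup_{m\ge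 0}\left|\mathrm{Var}_{\mathbb P_x}\Bigl(\sum_{k=m}^{m+n-1}a_k\Bigr)-n\sigma^2\right|\le C.$$ -/

import Mathlib

open MeasureTheory ProbabilityTheory Filter Topology

noncomputable section

namespace PosProd

/-- The norm `|x| = ∑ |x_i|` on `ℝ^d`. -/
def l1 {d : ℕ} (x : Fin d → ℝ) : ℝ := ∑ i, |x i|

/-- The cone of vectors with non-negative coordinates. -/
def cone (d : ℕ) : Set (Fin d → ℝ) := {x | ∀ i, 0 ≤ x i}

/-- The limited cone `𝕏 = {x ∈ cone : |x| = 1}`. -/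
def limitedCone (d : ℕ) : Set (Fin d → ℝ) := {x | x ∈ cone d ∧ l1 x = 1}

theorem l1_nonneg {d : ℕ} (x : Fin d → ℝ) : 0 ≤ l1 x :=
  Finset.sum_nonneg fun _ _ => abs_nonneg _

/-- The semigroup `S` of `d × d` matrices with non-negative entries each of whose columns contains
at least one positive entry; it contains the identity matrix. -/
def S (d : ℕ) : Submonoid (Matrix (Fin d) (Fin d) ℝ) where
  carrier := {g | (∀ i j, 0 ≤ g i j) ∧ ∀ j, ∃ i, 0 < g i j}
  one_mem' := by
    refine ⟨fun i j => ?_, fun j => ⟨j, by simp⟩⟩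
    rw [Matrix.one_apply]
    split_ifs <;> norm_num
  mul_mem' := by
    rintro g h ⟨hg, hg'⟩ ⟨hh, hh'⟩
    refine ⟨fun i j => ?_, fun j => ?_⟩
    · rw [Matrix.mul_apply]
      exact Finset.sum_nonneg fun k _ => mul_nonneg (hg i k) (hh k j)
    · obtain ⟨k, hk⟩ := hh' j
      obtain ⟨i, hi⟩ := hg' k
      refine ⟨i, ?_⟩
      rw [Matrix.mul_apply]
      exact Finset.sum_pos' (fun l _ => mul_nonneg (hg i l) (hh l j))
        ⟨k, Finset.mem_univ k, mul_pos hi hk⟩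

/-- `S` carries its Borel σ-algebra (for the topology induced by the entries). -/
instance instMeasurableSpaceS (d : ℕ) : MeasurableSpace (S d) := borel (S d)

instance instBorelSpaceS (d : ℕ) : BorelSpace (S d) := ⟨rfl⟩

instance instMeasurableMulS (d : ℕ) : MeasurableMul₂ (S d) := by
  have : SecondCountableTopology (Matrix (Fin d) (Fin d) ℝ) :=
    inferInstanceAs (SecondCountableTopology (Fin d → Fin d → ℝ))
  have : SecondCountableTopology (S d) :=
    TopologicalSpace.Subtype.secondCountableTopology _
  infer_instance

/-- The matrices with positive entries only. -/
def interiorS (d : ℕ) : Set (S d) := {g | ∀ i j, 0 < g.1 i j}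

/-- The linear action `g x`. -/
def lin {d : ℕ} (g : S d) (x : Fin d → ℝ) : Fin d → ℝ := g.1.mulVec x

theorem lin_mem_cone {d : ℕ} (g : S d) {x : Fin d → ℝ} (hx : x ∈ cone d) : lin g x ∈ cone d := by
  intro i
  change 0 ≤ ∑ j, g.1 i j * x j
  exact Finset.sum_nonneg fun j _ => mul_nonneg (g.2.1 i j) (hx j)

theorem l1_lin_pos {d : ℕ} (g : S d) (x : limitedCone d) : 0 < l1 (lin g x) := by
  obtain ⟨x, hx, hx1⟩ := x
  have hne : ∃ j, 0 < x j := by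
    by_contra hcon
    have h0 : ∀ j, x j = 0 := fun j => le_antisymm (not_lt.1 fun h => hcon ⟨j, h⟩) (hx j)
    simp [l1, h0] at hx1
  obtain ⟨j, hj⟩ := hne
  obtain ⟨i, hi⟩ := g.2.2 j
  have hpos : 0 < lin g x i :=
    Finset.sum_pos' (fun k _ => mul_nonneg (g.2.1 i k) (hx k))
      ⟨j, Finset.mem_univ j, mul_pos hi hj⟩
  exact Finset.sum_pos' (fun _ _ => abs_nonneg _) ⟨i, Finset.mem_univ i, abs_pos.2 hpos.ne'⟩

/-- The projective action `g · x = g x / |g x|` of `S` on the limited cone. -/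
def act {d : ℕ} (g : S d) (x : limitedCone d) : limitedCone d :=
  ⟨(l1 (lin g x))⁻¹ • lin g x, by
    refine ⟨fun i => mul_nonneg (inv_nonneg.2 (l1_nonneg _)) (lin_mem_cone g x.2.1 i), ?_⟩
    have h := l1_lin_pos g x
    have h' : l1 ((l1 (lin g x))⁻¹ • lin g x) = (l1 (lin g x))⁻¹ * l1 (lin g x) := by
      conv_lhs => unfold l1
      simp only [Pi.smul_apply, smul_eq_mul, abs_mul, ← Finset.mul_sum]
      rw [abs_of_nonneg (inv_nonneg.2 (Finset.sum_nonneg fun _ _ => abs_nonneg _))]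
      rfl
    rw [h', inv_mul_cancel₀ h.ne']⟩

/-- The cocycle `ρ(g, x) = log |g x|`. -/
def rho {d : ℕ} (g : S d) (x : limitedCone d) : ℝ := Real.log (l1 (lin g x))

/-- `v(g)`, the smallest column sum (`d ≥ 1`). -/
def colMin {d : ℕ} (g : S d) : ℝ := ⨅ j, ∑ i, g.1 i j

/-- `|g|`, the largest column sum (`d ≥ 1`). -/
def colMax {d : ℕ} (g : S d) : ℝ := ⨆ j, ∑ i, g.1 i j

/-- `N(g) = max (1 / v(g)) |g|`. -/
def N {d : ℕ} (g : S d) : ℝ := max (1 / colMin g) (colMax g)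

/-- The convolution power `μ^{*n}`: the law of a product of `n` independent matrices of law `μ`. -/
def convPow {d : ℕ} (μ : Measure (S d)) : ℕ → Measure (S d)
  | 0 => Measure.dirac 1
  | n + 1 => Measure.mconv μ (convPow μ n)

/-- `γ` is the upper Lyapunov exponent of `μ`: the limit of `n⁻¹ 𝔼 log |g_n ⋯ g_1|` for
independent `g_i` of law `μ`. -/
def IsUpperLyapunovExponent {d : ℕ} (μ : Measure (S d)) (γ : ℝ) : Prop :=
  Tendsto (fun n : ℕ => (n : ℝ)⁻¹ * ∫ g, Real.log (colMax g) ∂(convPow μ n)) atTop (𝓝 γ)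

/-- Moment condition. -/
def P1 {d : ℕ} (μ : Measure (S d)) : Prop :=
  ∃ δ₀ : ℝ, 0 < δ₀ ∧ Integrable (fun g => N g ^ δ₀) μ

/-- No affine subspace `A` meets the cone, outside the origin, in a bounded set that is mapped into
itself by all elements of the support of `μ`. (The origin has to be excluded, because
`{0}` is always an invariant affine subspace.) -/
def P2 {d : ℕ} (μ : Measure (S d)) : Prop :=
  ¬ ∃ A : AffineSubspace ℝ (Fin d → ℝ),
    (∃ x ∈ (A : Set (Fin d → ℝ)) ∩ cone d, x ≠ 0) ∧
    Bornology.IsBounded ((A : Set (Fin d → ℝ)) ∩ cone d) ∧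
    ∀ g ∈ μ.support, ∀ x ∈ (A : Set (Fin d → ℝ)) ∩ cone d,
      lin g x ∈ (A : Set (Fin d → ℝ)) ∩ cone d

/-- Products of matrices of law `μ` reach the positive matrices. -/
def P3 {d : ℕ} (μ : Measure (S d)) : Prop :=
  ∃ n₀ : ℕ, 1 ≤ n₀ ∧ 0 < convPow μ n₀ (interiorS d)

/-- The upper Lyapunov exponent is zero. -/
def P4 {d : ℕ} (μ : Measure (S d)) : Prop := IsUpperLyapunovExponent μ 0

/-- Uniform expansion with positive probability. -/
def P5 {d : ℕ} (μ : Measure (S d)) : Prop :=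
  ∃ δ : ℝ, 0 < δ ∧ 0 < μ {g | ∀ x : limitedCone d, δ ≤ Real.log (l1 (lin g x))}

/-- `L_0 = Id`, `L_n = g_n ⋯ g_1`. -/
def L {d : ℕ} {Ω : Type*} (g : ℕ → Ω → S d) : ℕ → Ω → S d
  | 0, _ => 1
  | n + 1, ω => g (n + 1) ω * L g n ω

/-- The Markov chain `X_n = L_n · x`, started at `x`. -/
def X {d : ℕ} {Ω : Type*} (g : ℕ → Ω → S d) (x : limitedCone d) (n : ℕ) (ω : Ω) : limitedCone d :=
  act (L g n ω) x

/-- The increments `a_k = ρ(g_k, X_{k-1})`, `k ≥ 1`, of the chain started at `x`. For `k = 0` the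
convention is that `g_0` is replaced by the identity and `X_{-1} = X_0 = x`,
so that `a_0 = ρ(Id, x)`, which is `0`. -/
def a {d : ℕ} {Ω : Type*} (g : ℕ → Ω → S d) (x : limitedCone d) : ℕ → Ω → ℝ
  | 0, _ => rho 1 x
  | k + 1, ω => rho (g (k + 1) ω) (X g x k ω)

/-- `a_m + ⋯ + a_{m+n-1}`, for the chain started at `x`. -/
def blockSum {d : ℕ} {Ω : Type*} (g : ℕ → Ω → S d) (x : limitedCone d) (m n : ℕ) (ω : Ω) : ℝ :=
  ∑ k ∈ Finset.Ico m (m + n), a g x k ω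

end PosProd

end

noncomputable section

namespace PosProd

variable {d : ℕ}

/-! The proof approximates the cocycle by a martingale. Let `P` be the transfer operator `f ↦ ∫ f(g
· x) μ(dg)`. Comparing points of the simplex through `α y ≤ x`, `β x ≤ y`, the quantity `1 - α β`
never grows under the action and shrinks by a fixed factor under a matrix with entries in `[ε,
ε⁻¹]`. By P3 such matrices occur with positive probability in `μ^{*n₀}`, so `P` contracts
projectively Lipschitz functions geometrically (`exists_geomContract`) and `P^n f` converges
uniformly to a constant.

For the mean increment `∫ ρ(g, x) μ(dg)` this constant is the Lyapunov exponent, which is zero by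
P4, so the Neumann series `θ = ∑ P^n (meanRho μ)` converges and solves the Poisson equation
(`GeomContract.exists_poisson`). Then `a_{k+1} + θ(X_{k+1}) - θ(X_k)` are square integrable
martingale differences: a block sum is a martingale `M` plus a coboundary bounded by `2B`.

By orthogonality, `Var M` is a sum of iterates `P^k (meanSq μ θ)(x)`, geometrically close to their
limit `σ²`, hence `n σ² + O(1)`. The covariance of `M` with the boundary term is also `O(1)`,
because the final position forgets earlier increments geometrically fast
(`IsIIDSeq.abs_integral_msum_mul_end_le`). Finally `σ² > 0`: by P5 a run of expanding matrices makes
`a_k` add up beyond the bounded coboundary with positive probability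
(`IsIIDSeq.pow_le_integral_msum_sq`). -/

theorem l1_of_mem_cone {x : Fin d → ℝ} (hx : x ∈ cone d) : l1 x = ∑ i, x i :=
  Finset.sum_congr rfl fun i _ => abs_of_nonneg (hx i)

theorem sum_limitedCone (x : limitedCone d) : ∑ i, x.1 i = 1 := by
  rw [← l1_of_mem_cone x.2.1]; exact x.2.2

/-! ### Linear action, projective action and the cocycle relation -/

theorem lin_apply (g : S d) (x : Fin d → ℝ) (i : Fin d) : lin g x i = ∑ j, g.1 i j * x j := rfl

theorem lin_mul (g h : S d) (x : Fin d → ℝ) : lin (g * h) x = lin g (lin h x) := by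
  simp [lin, Matrix.mulVec_mulVec]

theorem lin_one (x : Fin d → ℝ) : lin (1 : S d) x = x := by simp [lin]

theorem lin_smul (g : S d) (c : ℝ) (x : Fin d → ℝ) : lin g (c • x) = c • lin g x := by
  simp [lin, Matrix.mulVec_smul]

theorem l1_smul {c : ℝ} (hc : 0 ≤ c) (x : Fin d → ℝ) : l1 (c • x) = c * l1 x := by
  simp [l1, abs_mul, Finset.mul_sum, abs_of_nonneg hc]

theorem l1_lin (g : S d) {x : Fin d → ℝ} (hx : x ∈ cone d) :
    l1 (lin g x) = ∑ j, (∑ i, g.1 i j) * x j := by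
  rw [l1_of_mem_cone (lin_mem_cone g hx)]
  simp only [lin_apply, Finset.sum_mul]
  exact Finset.sum_comm

theorem act_val (g : S d) (x : limitedCone d) :
    (act g x).1 = (l1 (lin g x))⁻¹ • lin g x := rfl

theorem lin_act (g h : S d) (x : limitedCone d) :
    lin g (act h x).1 = (l1 (lin h x))⁻¹ • lin (g * h) x := by
  rw [act_val, lin_smul, lin_mul]

theorem l1_lin_act (g h : S d) (x : limitedCone d) :
    l1 (lin g (act h x).1) = (l1 (lin h x))⁻¹ * l1 (lin (g * h) x) := by
  rw [lin_act, l1_smul (inv_nonneg.2 (l1_nonneg _))]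

theorem act_mul (g h : S d) (x : limitedCone d) : act (g * h) x = act g (act h x) := by
  apply Subtype.ext
  have h1 := (l1_lin_pos h x).ne'
  have h2 := (l1_lin_pos (g * h) x).ne'
  rw [act_val, act_val, l1_lin_act, lin_act, smul_smul]
  congr 1
  field_simp

theorem act_one (x : limitedCone d) : act 1 x = x := by
  apply Subtype.ext
  rw [act_val, lin_one, x.2.2]; simp

theorem rho_one (x : limitedCone d) : rho 1 x = 0 := by
  simp [rho, lin_one, x.2.2]

theorem rho_mul (g h : S d) (x : limitedCone d) :
    rho (g * h) x = rho g (act h x) + rho h x := by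
  have h1 := (l1_lin_pos h x).ne'
  have h2 := (l1_lin_pos (g * h) x).ne'
  rw [rho, rho, rho, l1_lin_act, Real.log_mul (inv_ne_zero h1) h2, Real.log_inv]
  ring

/-! ### Column sums as bounds for the cocycle -/

theorem colMin_le (g : S d) (j : Fin d) : colMin g ≤ ∑ i, g.1 i j :=
  ciInf_le (Set.finite_range _).bddBelow j

theorem le_colMax (g : S d) (j : Fin d) : ∑ i, g.1 i j ≤ colMax g :=
  le_ciSup (f := fun j => ∑ i, g.1 i j) (Set.finite_range _).bddAbove j

theorem colMin_pos (hd : 1 ≤ d) (g : S d) : 0 < colMin g := by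
  have : Nonempty (Fin d) := ⟨⟨0, hd⟩⟩
  obtain ⟨j, hj⟩ := exists_eq_ciInf_of_finite (f := fun j => ∑ i, g.1 i j)
  rw [colMin, ← hj]
  obtain ⟨i, hi⟩ := g.2.2 j
  exact Finset.sum_pos' (fun l _ => g.2.1 l j) ⟨i, Finset.mem_univ i, hi⟩

theorem colMin_le_colMax (hd : 1 ≤ d) (g : S d) : colMin g ≤ colMax g :=
  (colMin_le g ⟨0, hd⟩).trans (le_colMax g _)

theorem colMax_pos (hd : 1 ≤ d) (g : S d) : 0 < colMax g :=
  (colMin_pos hd g).trans_le (colMin_le_colMax hd g)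

theorem colMin_le_l1_lin (g : S d) (x : limitedCone d) : colMin g ≤ l1 (lin g x) := by
  rw [l1_lin g x.2.1]
  calc colMin g = ∑ j, colMin g * x.1 j := by
        rw [← Finset.mul_sum, sum_limitedCone, mul_one]
    _ ≤ _ := Finset.sum_le_sum fun j _ => mul_le_mul_of_nonneg_right (colMin_le g j) (x.2.1 j)

theorem l1_lin_le_colMax (g : S d) (x : limitedCone d) : l1 (lin g x) ≤ colMax g := by
  rw [l1_lin g x.2.1]
  calc _ ≤ ∑ j, colMax g * x.1 j :=
        Finset.sum_le_sum fun j _ => mul_le_mul_of_nonneg_right (le_colMax g j) (x.2.1 j)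
    _ = colMax g := by rw [← Finset.mul_sum, sum_limitedCone, mul_one]

theorem one_le_N (hd : 1 ≤ d) (g : S d) : 1 ≤ N g := by
  rcases le_total 1 (colMax g) with h | h
  · exact h.trans (le_max_right _ _)
  · refine le_trans ?_ (le_max_left _ _)
    rw [le_div_iff₀ (colMin_pos hd g), one_mul]
    exact (colMin_le_colMax hd g).trans h

theorem log_N_nonneg (hd : 1 ≤ d) (g : S d) : 0 ≤ Real.log (N g) := Real.log_nonneg (one_le_N hd g)

theorem abs_rho_le (hd : 1 ≤ d) (g : S d) (x : limitedCone d) : |rho g x| ≤ Real.log (N g) := by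
  have hpos := l1_lin_pos g x
  have hN : 0 < N g := zero_lt_one.trans_le (one_le_N hd g)
  rw [abs_le]
  constructor
  · rw [← Real.log_inv]
    refine Real.log_le_log (inv_pos.2 hN) (le_trans ?_ (colMin_le_l1_lin g x))
    rw [inv_le_comm₀ hN (colMin_pos hd g), ← one_div]
    exact le_max_left _ _
  · exact Real.log_le_log hpos ((l1_lin_le_colMax g x).trans (le_max_right _ _))

/-- The barycentre of the simplex. -/
def barycentre (hd : 1 ≤ d) : limitedCone d :=
  ⟨fun _ => (d : ℝ)⁻¹, fun _ => by positivity, by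
    have : (d : ℝ) ≠ 0 := by positivity
    simp [l1, this]⟩

/-- The barycentre gives each column weight `1/d`, so the heaviest column alone contributes `|g|/d`.
This lets the Lyapunov exponent, defined through `log |g|`, be computed from the cocycle at one
point. -/
theorem abs_log_colMax_sub_rho_le (hd : 1 ≤ d) (g : S d) :
    |Real.log (colMax g) - rho g (barycentre hd)| ≤ Real.log d := by
  have : Nonempty (Fin d) := ⟨⟨0, hd⟩⟩
  have hd0 : (0 : ℝ) < d := by positivity
  have hd1 : (1 : ℝ) ≤ d := by exact_mod_cast hd
  have h1 := Real.log_le_log (l1_lin_pos g _) (l1_lin_le_colMax g (barycentre hd))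
  have h2 : colMax g * (d : ℝ)⁻¹ ≤ l1 (lin g (barycentre hd)) := by
    obtain ⟨j, hj⟩ := exists_eq_ciSup_of_finite (f := fun j => ∑ i, g.1 i j)
    rw [colMax, ← hj, l1_lin g (barycentre hd).2.1]
    exact Finset.single_le_sum (f := fun j => (∑ i, g.1 i j) * (d : ℝ)⁻¹)
      (fun k _ => mul_nonneg (Finset.sum_nonneg fun i _ => g.2.1 i k) (by positivity))
      (Finset.mem_univ j)
  have h3 := Real.log_le_log (mul_pos (colMax_pos hd g) (inv_pos.2 hd0)) h2
  rw [Real.log_mul (colMax_pos hd g).ne' (inv_pos.2 hd0).ne', Real.log_inv] at h3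
  have h4 := Real.log_nonneg hd1
  rw [abs_le]
  constructor <;> simp only [rho] at * <;> linarith

/-! ### Projective comparison and its contraction by positive matrices -/

/-- `α y ≤ x` and `β x ≤ y` coordinatewise. -/
def Compar (α β : ℝ) (x y : limitedCone d) : Prop :=
  0 ≤ α ∧ 0 ≤ β ∧ (∀ i, α * y.1 i ≤ x.1 i) ∧ ∀ i, β * x.1 i ≤ y.1 i

theorem Compar.left_le_one {α β : ℝ} {x y : limitedCone d} (h : Compar α β x y) : α ≤ 1 := by
  have := Finset.sum_le_sum fun i (_ : i ∈ Finset.univ) => h.2.2.1 i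
  rwa [← Finset.mul_sum, sum_limitedCone, sum_limitedCone, mul_one] at this

theorem Compar.symm {α β : ℝ} {x y : limitedCone d} (h : Compar α β x y) : Compar β α y x :=
  ⟨h.2.1, h.1, h.2.2.2, h.2.2.1⟩

theorem Compar.mul_le_one {α β : ℝ} {x y : limitedCone d} (h : Compar α β x y) : α * β ≤ 1 :=
  mul_le_one₀ h.left_le_one h.2.1 h.symm.left_le_one

theorem compar_zero (x y : limitedCone d) : Compar 0 0 x y :=
  ⟨le_rfl, le_rfl, fun i => by simpa using x.2.1 i, fun i => by simpa using y.2.1 i⟩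

theorem lin_le_lin (g : S d) {α : ℝ} {x y : Fin d → ℝ} (h : ∀ i, α * y i ≤ x i) (i : Fin d) :
    α * lin g y i ≤ lin g x i := by
  rw [lin_apply, lin_apply, Finset.mul_sum]
  refine Finset.sum_le_sum fun j _ => ?_
  have := mul_le_mul_of_nonneg_left (h j) (g.2.1 i j)
  linarith

/-- Normalising multiplies `α` by `|g y| / |g x|` and `β` by the inverse ratio; hence only the
product `α β` is tracked. -/
theorem compar_act_of_lin (g : S d) {α β : ℝ} {x y : limitedCone d} (hα : 0 ≤ α) (hβ : 0 ≤ β)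
    (h1 : ∀ i, α * lin g y i ≤ lin g x i) (h2 : ∀ i, β * lin g x i ≤ lin g y i) :
    ∃ α' β', α' * β' = α * β ∧ Compar α' β' (act g x) (act g y) := by
  have hx := l1_lin_pos g x
  have hy := l1_lin_pos g y
  refine ⟨α * l1 (lin g y) / l1 (lin g x), β * l1 (lin g x) / l1 (lin g y), by field_simp,
    by positivity, by positivity, fun i => ?_, fun i => ?_⟩
  · rw [act_val, act_val, Pi.smul_apply, Pi.smul_apply, smul_eq_mul, smul_eq_mul]
    have := mul_le_mul_of_nonneg_left (h1 i) (inv_nonneg.2 hx.le)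
    refine le_trans (le_of_eq ?_) this
    field_simp
  · rw [act_val, act_val, Pi.smul_apply, Pi.smul_apply, smul_eq_mul, smul_eq_mul]
    have := mul_le_mul_of_nonneg_left (h2 i) (inv_nonneg.2 hy.le)
    refine le_trans (le_of_eq ?_) this
    field_simp

theorem Compar.act {α β : ℝ} {x y : limitedCone d} (h : Compar α β x y) (g : S d) :
    ∃ α' β', α' * β' = α * β ∧ Compar α' β' (PosProd.act g x) (PosProd.act g y) :=
  compar_act_of_lin g h.1 h.2.1 (lin_le_lin g h.2.2.1) (lin_le_lin g h.2.2.2)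

/-- Matrices all of whose entries lie in `[ε, ε⁻¹]`. -/
def boundedS (d : ℕ) (ε : ℝ) : Set (S d) := {g | ∀ i j, ε ≤ g.1 i j ∧ g.1 i j ≤ ε⁻¹}

/-- The non-negative vector `x - α y` has mass `1 - α`, so every coordinate of its image is at least
`ε (1 - α)`, while the coordinates of `g y` are at most `ε⁻¹`. -/
theorem lin_le_lin_of_mem_boundedS {ε : ℝ} (hε : 0 < ε) {g : S d} (hg : g ∈ boundedS d ε)
    {α : ℝ} {x y : limitedCone d} (h : ∀ i, α * y.1 i ≤ x.1 i) (i : Fin d) :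
    (α + ε ^ 2 * (1 - α)) * lin g y i ≤ lin g x i := by
  have h1 : ε * (1 - α) ≤ lin g x i - α * lin g y i := by
    have e1 : ε * (1 - α) = ∑ j, ε * (x.1 j - α * y.1 j) := by
      rw [← Finset.mul_sum, Finset.sum_sub_distrib, ← Finset.mul_sum, sum_limitedCone,
        sum_limitedCone, mul_one]
    rw [e1, lin_apply, lin_apply, Finset.mul_sum, ← Finset.sum_sub_distrib]
    refine Finset.sum_le_sum fun j _ => ?_
    have := mul_le_mul_of_nonneg_right (hg i j).1 (sub_nonneg.2 (h j))
    linarith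
  have h2 : lin g y i ≤ ε⁻¹ := by
    calc lin g y i = ∑ j, g.1 i j * y.1 j := rfl
      _ ≤ ∑ j, ε⁻¹ * y.1 j :=
        Finset.sum_le_sum fun j _ => mul_le_mul_of_nonneg_right (hg i j).2 (y.2.1 j)
      _ = ε⁻¹ := by rw [← Finset.mul_sum, sum_limitedCone, mul_one]
  have hα : α ≤ 1 := by
    have := Finset.sum_le_sum fun i (_ : i ∈ Finset.univ) => h i
    rwa [← Finset.mul_sum, sum_limitedCone, sum_limitedCone, mul_one] at this
  have h3 : ε ^ 2 * (1 - α) * lin g y i ≤ ε ^ 2 * (1 - α) * ε⁻¹ :=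
    mul_le_mul_of_nonneg_left h2 (mul_nonneg (by positivity) (sub_nonneg.2 hα))
  have h4 : ε ^ 2 * (1 - α) * ε⁻¹ = ε * (1 - α) := by field_simp
  linarith

theorem Compar.act_of_mem_boundedS {α β : ℝ} {x y : limitedCone d} (h : Compar α β x y)
    {ε : ℝ} (hε : 0 < ε) (hε1 : ε ≤ 1) {g : S d} (hg : g ∈ boundedS d ε) :
    ∃ α' β', 1 - α' * β' ≤ (1 - ε ^ 4) * (1 - α * β) ∧
      Compar α' β' (PosProd.act g x) (PosProd.act g y) := by
  have hα := h.left_le_one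
  have hβ := h.symm.left_le_one
  have hα0 := h.1
  have hβ0 := h.2.1
  have hε2 : ε ^ 2 ≤ 1 := pow_le_one₀ hε.le hε1
  have hu : 0 ≤ 1 - α := sub_nonneg.2 hα
  have hv : 0 ≤ 1 - β := sub_nonneg.2 hβ
  obtain ⟨α', β', h1, h2⟩ := compar_act_of_lin g (α := α + ε ^ 2 * (1 - α))
    (β := β + ε ^ 2 * (1 - β)) (by positivity) (by positivity)
    (lin_le_lin_of_mem_boundedS hε hg h.2.2.1) (lin_le_lin_of_mem_boundedS hε hg h.2.2.2)
  refine ⟨α', β', ?_, h2⟩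
  rw [h1]
  set κ := ε ^ 2 with hκ
  have hκ4 : ε ^ 4 = κ ^ 2 := by rw [hκ]; ring
  have hκ0 : 0 ≤ κ := by positivity
  -- Both `α` and `β` move a fraction `κ = ε²` of the way to `1`. The last factor equals `α (1 - β)
  -- + β (1 - α)`, hence is non-negative.
  have key : (1 - κ ^ 2) * (1 - α * β) - (1 - (α + κ * (1 - α)) * (β + κ * (1 - β)))
      = (1 - κ) * κ * (1 - α * β - (1 - α) * (1 - β)) := by ring
  have h5 : 0 ≤ 1 - α * β - (1 - α) * (1 - β) := by nlinarith
  have h6 : 0 ≤ (1 - κ) * κ * (1 - α * β - (1 - α) * (1 - β)) :=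
    mul_nonneg (mul_nonneg (sub_nonneg.2 hε2) hκ0) h5
  rw [hκ4]
  linarith

theorem log_le_rho_sub (g : S d) {α : ℝ} (hα : 0 < α) {x y : limitedCone d}
    (h : ∀ i, α * y.1 i ≤ x.1 i) : Real.log α ≤ rho g x - rho g y := by
  have h1 : α * l1 (lin g y) ≤ l1 (lin g x) := by
    rw [l1_of_mem_cone (lin_mem_cone g x.2.1), l1_of_mem_cone (lin_mem_cone g y.2.1),
      Finset.mul_sum]
    exact Finset.sum_le_sum fun i _ => lin_le_lin g h i
  have h2 := Real.log_le_log (mul_pos hα (l1_lin_pos g y)) h1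
  rw [Real.log_mul hα.ne' (l1_lin_pos g y).ne'] at h2
  simp only [rho]
  linarith

theorem Compar.abs_rho_sub_le (hd : 1 ≤ d) {α β : ℝ} {x y : limitedCone d} (h : Compar α β x y)
    (g : S d) : |rho g x - rho g y| ≤ (2 + 4 * Real.log (N g)) * (1 - α * β) := by
  have hl := log_N_nonneg hd g
  have h1 := h.mul_le_one
  -- For `α β ≤ 1/2` the trivial bound `2 log N(g)` suffices; otherwise `log α` and `log β` control
  -- the difference, and `-log (α β) ≤ 2 (1 - α β)`.
  rcases le_total (α * β) (1 / 2) with h2 | h2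
  · have h3 := abs_sub (rho g x) (rho g y)
    have h4 := abs_rho_le hd g x
    have h5 := abs_rho_le hd g y
    nlinarith
  · have hα : 0 < α := lt_of_le_of_ne h.1 (by rintro rfl; norm_num at h2)
    have hβ : 0 < β := lt_of_le_of_ne h.2.1 (by rintro rfl; norm_num at h2)
    have h3 := log_le_rho_sub g hα h.2.2.1
    have h4 := log_le_rho_sub g hβ h.2.2.2
    have h5 := Real.log_nonpos hα.le h.left_le_one
    have h6 := Real.log_nonpos hβ.le h.symm.left_le_one
    have h7 := Real.one_sub_inv_le_log_of_pos (mul_pos hα hβ)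
    have h8 : (α * β)⁻¹ - 1 ≤ 2 * (1 - α * β) := by
      have : (α * β)⁻¹ ≤ 2 := by
        rw [inv_le_comm₀ (mul_pos hα hβ) two_pos]; linarith
      have e : (α * β)⁻¹ - 1 = (α * β)⁻¹ * (1 - α * β) := by field_simp
      rw [e]
      exact mul_le_mul_of_nonneg_right this (sub_nonneg.2 h1)
    rw [Real.log_mul hα.ne' hβ.ne'] at h7
    have h9 : 0 ≤ 4 * Real.log (N g) * (1 - α * β) :=
      mul_nonneg (by positivity) (sub_nonneg.2 h1)
    rw [abs_le]
    constructor <;> nlinarith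

/-! ### Measurability -/


theorem measurable_entry (i j : Fin d) : Measurable fun g : S d => g.1 i j := by
  have : Continuous fun g : S d => g.1 i j :=
    (continuous_subtype_val (p := fun g => g ∈ S d)).matrix_elem i j
  exact this.measurable


theorem measurable_coord (i : Fin d) : Measurable fun x : limitedCone d => x.1 i :=
  (measurable_pi_apply i).comp measurable_subtype_coe

theorem measurable_lin : Measurable fun p : S d × limitedCone d => lin p.1 p.2.1 := by
  refine measurable_pi_lambda _ fun i => ?_
  simp only [lin_apply]
  refine Finset.measurable_sum _ fun j _ => ?_
  exact ((measurable_entry i j).comp measurable_fst).mul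
    ((measurable_coord j).comp measurable_snd)

theorem measurable_l1 : Measurable (l1 : (Fin d → ℝ) → ℝ) :=
  Finset.measurable_sum _ fun i _ => (measurable_pi_apply i).abs

theorem measurable_l1_lin : Measurable fun p : S d × limitedCone d => l1 (lin p.1 p.2.1) :=
  measurable_l1.comp measurable_lin

theorem measurable_act : Measurable fun p : S d × limitedCone d => act p.1 p.2 := by
  refine Measurable.subtype_mk ?_
  exact measurable_l1_lin.inv.smul measurable_lin

theorem measurable_rho : Measurable fun p : S d × limitedCone d => rho p.1 p.2 :=
  Real.measurable_log.comp measurable_l1_lin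

theorem measurable_colMin : Measurable (colMin : S d → ℝ) :=
  Measurable.iInf fun j => Finset.measurable_sum _ fun i _ => measurable_entry i j

theorem measurable_colMax : Measurable (colMax : S d → ℝ) :=
  Measurable.iSup fun j => Finset.measurable_sum _ fun i _ => measurable_entry i j

theorem measurable_N : Measurable (N : S d → ℝ) :=
  (measurable_const.div measurable_colMin).max measurable_colMax

theorem measurable_log_N : Measurable fun g : S d => Real.log (N g) :=
  Real.measurable_log.comp measurable_N

theorem measurableSet_boundedS (ε : ℝ) : MeasurableSet (boundedS d ε) := by
  have : boundedS d ε = ⋂ i, ⋂ j, {g : S d | ε ≤ g.1 i j ∧ g.1 i j ≤ ε⁻¹} := by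
    ext g; simp [boundedS]
  rw [this]
  exact MeasurableSet.iInter fun i => MeasurableSet.iInter fun j =>
    (measurableSet_le measurable_const (measurable_entry i j)).inter
      (measurableSet_le (measurable_entry i j) measurable_const)

theorem interiorS_subset_iUnion :
    interiorS d ⊆ ⋃ n : ℕ, boundedS d ((n : ℝ) + 1)⁻¹ := by
  intro g hg
  -- One integer dominating all entries and all their inverses.
  obtain ⟨n, hn⟩ := exists_nat_ge (∑ i, ∑ j, (g.1 i j + (g.1 i j)⁻¹))
  refine Set.mem_iUnion.2 ⟨n, fun i j => ?_⟩
  have hpos := hg i j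
  have h0 : ∀ k l, 0 ≤ g.1 k l + (g.1 k l)⁻¹ := fun k l =>
    add_nonneg (g.2.1 k l) (inv_nonneg.2 (g.2.1 k l))
  have h1 : g.1 i j + (g.1 i j)⁻¹ ≤ n := by
    refine le_trans ?_ hn
    refine le_trans ?_ (Finset.single_le_sum (f := fun k => ∑ l, (g.1 k l + (g.1 k l)⁻¹))
      (fun k _ => Finset.sum_nonneg fun l _ => h0 k l) (Finset.mem_univ i))
    exact Finset.single_le_sum (f := fun l => g.1 i l + (g.1 i l)⁻¹)
      (fun l _ => h0 i l) (Finset.mem_univ j)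
  have h2 := inv_pos.2 hpos
  constructor
  · rw [inv_le_comm₀ (by positivity) hpos]; linarith
  · rw [inv_inv]; linarith

theorem measurableSet_expanding (δ : ℝ) :
    MeasurableSet {g : S d | ∀ x : limitedCone d, δ ≤ Real.log (l1 (lin g x))} := by
  have : {g : S d | ∀ x : limitedCone d, δ ≤ Real.log (l1 (lin g x))} =
      ⋂ x : limitedCone d, {g : S d | δ ≤ Real.log (l1 (lin g x))} := by ext; simp
  rw [this]
  -- The intersection over `x` is uncountable, so measurability comes from closedness.
  refine IsClosed.measurableSet (isClosed_iInter fun x => isClosed_le continuous_const ?_)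
  refine Continuous.log ?_ fun g => (l1_lin_pos g x).ne'
  refine continuous_finsetSum _ fun i _ => Continuous.abs ?_
  simp only [lin_apply]
  exact continuous_finsetSum _ fun j _ =>
    ((continuous_subtype_val (p := fun g => g ∈ S d)).matrix_elem i j).mul continuous_const

/-! ### The transfer operator -/

/-- The Markov operator `f ↦ ∫ f(g · x) ν(dg)`. -/
def transfer (ν : Measure (S d)) (f : limitedCone d → ℝ) (x : limitedCone d) : ℝ :=
  ∫ g, f (act g x) ∂ν

/-- Lipschitz functions for the projective distance
`(x, y) ↦ inf {1 - α β : α y ≤ x, β x ≤ y}`. -/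
def ProjLip (K : ℝ) (f : limitedCone d → ℝ) : Prop :=
  ∀ x y α β, Compar α β x y → |f x - f y| ≤ K * (1 - α * β)

/-- The trivial comparison `α = β = 0` is always available, so the Lipschitz constant also bounds
the oscillation. -/
theorem ProjLip.abs_sub_le {K : ℝ} {f : limitedCone d → ℝ} (h : ProjLip K f)
    (x y : limitedCone d) : |f x - f y| ≤ K := by
  simpa using h x y 0 0 (compar_zero x y)

theorem ProjLip.mono {K K' : ℝ} {f : limitedCone d → ℝ} (h : ProjLip K f) (hK : K ≤ K') :
    ProjLip K' f := fun x y α β hc =>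
  (h x y α β hc).trans (mul_le_mul_of_nonneg_right hK (sub_nonneg.2 hc.mul_le_one))

theorem ProjLip.nonneg {K : ℝ} {f : limitedCone d → ℝ} (h : ProjLip K f)
    (x : limitedCone d) : 0 ≤ K := (abs_nonneg _).trans (h.abs_sub_le x x)

theorem ProjLip.abs_le {K : ℝ} {f : limitedCone d → ℝ} (h : ProjLip K f)
    (x y : limitedCone d) : |f y| ≤ |f x| + K := by
  have h1 := h.abs_sub_le y x
  have h2 := abs_sub_abs_le_abs_sub (f y) (f x)
  linarith

theorem measurable_act_left (x : limitedCone d) : Measurable fun g : S d => act g x := by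
  have h := Measurable.comp (g := fun p : S d × limitedCone d => act p.1 p.2)
    (f := fun g => (g, x)) measurable_act measurable_prodMk_right
  exact h

theorem measurable_rho_left (x : limitedCone d) : Measurable fun g : S d => rho g x := by
  have h := Measurable.comp (g := fun p : S d × limitedCone d => rho p.1 p.2)
    (f := fun g => (g, x)) measurable_rho measurable_prodMk_right
  exact h

section Transfer

variable {ν : Measure (S d)} [IsProbabilityMeasure ν]

theorem integrable_comp_act_of_bound {f : limitedCone d → ℝ} (hf : Measurable f) {B : ℝ}
    (hB : ∀ x, |f x| ≤ B) (x : limitedCone d) : Integrable (fun g => f (act g x)) ν :=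
  .of_bound (hf.comp (measurable_act_left x)).aestronglyMeasurable B (ae_of_all _ fun _ => hB _)

theorem ProjLip.integrable {K : ℝ} {f : limitedCone d → ℝ} (h : ProjLip K f) (hf : Measurable f)
    (x : limitedCone d) : Integrable (fun g => f (act g x)) ν :=
  integrable_comp_act_of_bound hf (h.abs_le x) x

theorem measurable_transfer {f : limitedCone d → ℝ} (hf : Measurable f) :
    Measurable (transfer ν f) := by
  have h : StronglyMeasurable fun p : limitedCone d × S d => f (act p.2 p.1) :=
    (hf.comp (measurable_act.comp measurable_swap)).stronglyMeasurable
  exact (h.integral_prod_right (ν := ν)).measurable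

theorem abs_sub_transfer_le {f : limitedCone d → ℝ} (hf : Measurable f) {a B : ℝ}
    (hB : ∀ x, |a - f x| ≤ B) (x : limitedCone d) : |a - transfer ν f x| ≤ B := by
  have hb : ∀ x, |f x| ≤ B + |a| := fun x => by
    have h1 := hB x
    have h2 := abs_sub_abs_le_abs_sub (f x) a
    rw [abs_sub_comm] at h1
    linarith
  have hi := integrable_comp_act_of_bound (ν := ν) hf hb x
  have e : a - transfer ν f x = ∫ g, (a - f (act g x)) ∂ν := by
    rw [integral_sub (integrable_const _) hi]; simp [transfer]
  rw [e]
  simpa using norm_integral_le_of_norm_le_const (μ := ν) (f := fun g => a - f (act g x))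
    (ae_of_all _ fun g => hB (act g x))

theorem abs_transfer_sub_le {K : ℝ} {f : limitedCone d → ℝ} (h : ProjLip K f) (hf : Measurable f)
    (x y : limitedCone d) :
    |transfer ν f x - transfer ν f y| ≤ ∫ g, |f (act g x) - f (act g y)| ∂ν := by
  rw [transfer, transfer, ← integral_sub (h.integrable hf x) (h.integrable hf y)]
  exact abs_integral_le_integral_abs

theorem ProjLip.transfer {K : ℝ} {f : limitedCone d → ℝ} (h : ProjLip K f) (hf : Measurable f) :
    ProjLip K (transfer ν f) := by
  intro x y α β hc
  refine (abs_transfer_sub_le h hf x y).trans ?_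
  have hle : ∀ g : S d, |f (act g x) - f (act g y)| ≤ K * (1 - α * β) := fun g => by
    obtain ⟨α', β', e, hc'⟩ := hc.act g
    rw [← e]
    exact h _ _ _ _ hc'
  calc _ ≤ ∫ _, K * (1 - α * β) ∂ν :=
        integral_mono ((h.integrable hf x).sub (h.integrable hf y)).abs (integrable_const _) hle
    _ = _ := by simp

/-- Matrices in `boundedS d ε` save the fraction `ε ^ 4` of `1 - α β`, the others do not expand it;
averaging saves `ε ^ 4` times the probability of the former. -/
theorem ProjLip.transfer_of_boundedS {K : ℝ} {f : limitedCone d → ℝ} (h : ProjLip K f)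
    (hf : Measurable f) {ε : ℝ} (hε : 0 < ε) (hε1 : ε ≤ 1) :
    ProjLip ((1 - ε ^ 4 * ν.real (boundedS d ε)) * K) (PosProd.transfer ν f) := by
  intro x y α β hc
  refine (abs_transfer_sub_le h hf x y).trans ?_
  have hK := h.nonneg x
  set D := 1 - α * β with hD
  have hD0 : 0 ≤ D := sub_nonneg.2 hc.mul_le_one
  have hms := measurableSet_boundedS (d := d) ε
  have hle : ∀ g : S d, |f (act g x) - f (act g y)| ≤
      K * D - (boundedS d ε).indicator (fun _ => ε ^ 4 * K * D) g := fun g => by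
    by_cases hg : g ∈ boundedS d ε
    · obtain ⟨α', β', e, hc'⟩ := hc.act_of_mem_boundedS hε hε1 hg
      rw [Set.indicator_of_mem hg]
      have h1 := h _ _ _ _ hc'
      have h2 := mul_le_mul_of_nonneg_left e hK
      linarith
    · obtain ⟨α', β', e, hc'⟩ := hc.act g
      rw [Set.indicator_of_notMem hg, hD, ← e, sub_zero]
      exact h _ _ _ _ hc'
  have hi : Integrable (fun g => (boundedS d ε).indicator (fun _ => ε ^ 4 * K * D) g) ν :=
    (integrable_const _).indicator hms
  calc _ ≤ ∫ g, (K * D - (boundedS d ε).indicator (fun _ => ε ^ 4 * K * D) g) ∂ν :=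
        integral_mono ((h.integrable hf x).sub (h.integrable hf y)).abs
          ((integrable_const _).sub hi) hle
    _ = _ := by
      rw [integral_sub (integrable_const _) hi, integral_indicator_const _ hms]
      simp
      ring

end Transfer

/-! ### Convolution powers, geometric contraction and the Poisson equation -/

section ConvPow

variable {μ : Measure (S d)} [IsProbabilityMeasure μ]

instance isProbabilityMeasure_convPow (n : ℕ) : IsProbabilityMeasure (convPow μ n) := by
  induction n with
  | zero => rw [convPow]; infer_instance
  | succ n ih => rw [convPow]; infer_instance

omit [IsProbabilityMeasure μ] in
theorem integrable_convPow_succ {F : S d → ℝ} (hF : Measurable F) {n : ℕ} :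
    Integrable F (convPow μ (n + 1)) ↔
      Integrable (fun p : S d × S d => F (p.1 * p.2)) (μ.prod (convPow μ n)) :=
  integrable_map_measure hF.aestronglyMeasurable (by fun_prop)

theorem integral_convPow_succ {F : S d → ℝ} (hF : Measurable F) {n : ℕ}
    (hi : Integrable F (convPow μ (n + 1))) :
    ∫ g, F g ∂(convPow μ (n + 1)) = ∫ h, ∫ g, F (g * h) ∂μ ∂(convPow μ n) := by
  rw [convPow, Measure.mconv, integral_map (by fun_prop) hF.aestronglyMeasurable,
    integral_prod_symm _ ((integrable_convPow_succ hF).1 hi)]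

theorem transfer_convPow {K : ℝ} (n : ℕ) {f : limitedCone d → ℝ} (hf : Measurable f)
    (h : ProjLip K f) : transfer (convPow μ n) f = (transfer μ)^[n] f := by
  induction n generalizing f with
  | zero => ext x; simp [transfer, convPow, act_one]
  | succ n ih =>
    rw [Function.iterate_succ_apply, ← ih (measurable_transfer hf) (h.transfer hf)]
    ext x
    have h1 := integral_convPow_succ (F := fun g => f (act g x))
      (hf.comp (measurable_act_left x)) (h.integrable hf x (ν := convPow μ (n + 1)))
    simp only [act_mul] at h1
    exact h1

theorem measurable_iterate_transfer {f : limitedCone d → ℝ} (hf : Measurable f) (n : ℕ) :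
    Measurable ((transfer μ)^[n] f) := by
  induction n generalizing f with
  | zero => exact hf
  | succ n ih => exact ih (measurable_transfer hf)

theorem ProjLip.iterate_transfer {K : ℝ} {f : limitedCone d → ℝ} (h : ProjLip K f)
    (hf : Measurable f) (n : ℕ) : ProjLip K ((PosProd.transfer μ)^[n] f) := by
  rw [← transfer_convPow n hf h]; exact h.transfer hf

theorem abs_sub_iterate_transfer_le {f : limitedCone d → ℝ} (hf : Measurable f) {a B : ℝ}
    (hB : ∀ x, |a - f x| ≤ B) (n : ℕ) (x : limitedCone d) :
    |a - (transfer μ)^[n] f x| ≤ B := by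
  induction n generalizing f with
  | zero => exact hB x
  | succ n ih =>
    exact ih (measurable_transfer hf) fun y => abs_sub_transfer_le hf hB y

/-- The iterates of the transfer operator contract projectively Lipschitz functions
geometrically. -/
def GeomContract (μ : Measure (S d)) (C q : ℝ) : Prop :=
  0 < C ∧ 0 < q ∧ q < 1 ∧ ∀ K f, Measurable f → ProjLip K f →
    ∀ n, ProjLip (C * q ^ n * K) ((transfer μ)^[n] f)

theorem exists_boundedS_pos {ν : Measure (S d)} (h : 0 < ν (interiorS d)) :
    ∃ ε : ℝ, 0 < ε ∧ ε ≤ 1 ∧ 0 < ν (boundedS d ε) := by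
  by_contra hcon
  push Not at hcon
  refine h.ne' (measure_mono_null interiorS_subset_iUnion (measure_iUnion_null fun n => ?_))
  have h1 : (1 : ℝ) ≤ n + 1 := by simp
  exact nonpos_iff_eq_zero.1 (hcon ((n : ℝ) + 1)⁻¹ (by positivity) (inv_le_one_of_one_le₀ h1))

theorem exists_geomContract (hd : 1 ≤ d) (h3 : P3 μ) : ∃ C q, GeomContract μ C q := by
  obtain ⟨n₀, hn₀, hpos⟩ := h3
  obtain ⟨ε, hε, hε1, hp⟩ := exists_boundedS_pos hpos
  set p := (convPow μ n₀).real (boundedS d ε)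
  have hp0 : 0 < p := ENNReal.toReal_pos hp.ne' (measure_ne_top _ _)
  -- The `1/2` keeps `r` positive, so that the root `q = r ^ (1/n₀)` and the constant `r⁻¹` are
  -- positive.
  set r : ℝ := max (1 - ε ^ 4 * p) (1 / 2) with hr
  have hr0 : 0 < r := lt_of_lt_of_le (by norm_num) (le_max_right _ _)
  have hr1 : r < 1 := by
    have : 0 < ε ^ 4 * p := by positivity
    exact max_lt (by linarith) (by norm_num)
  have hn₀' : (n₀ : ℝ) ≠ 0 := by positivity
  set q : ℝ := r ^ (1 / n₀ : ℝ) with hq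
  have hq0 : 0 < q := Real.rpow_pos_of_pos hr0 _
  have hq1 : q < 1 := Real.rpow_lt_one hr0.le hr1 (by positivity)
  have hqn : q ^ n₀ = r := by
    rw [hq, ← Real.rpow_natCast, ← Real.rpow_mul hr0.le, one_div, inv_mul_cancel₀ hn₀',
      Real.rpow_one]
  refine ⟨r⁻¹, q, inv_pos.2 hr0, hq0, hq1, fun K f hf h n => ?_⟩
  have hK := h.nonneg (barycentre hd)
  have hstep : ∀ k, ProjLip (r ^ k * K) ((transfer μ)^[n₀ * k] f) := by
    intro k
    induction k with
    | zero => simpa using h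
    | succ k ih =>
      have hm := measurable_iterate_transfer (μ := μ) hf (n₀ * k)
      have h1 := ih.transfer_of_boundedS (ν := convPow μ n₀) hm hε hε1
      rw [transfer_convPow n₀ hm ih, ← Function.iterate_add_apply] at h1
      rw [mul_add, mul_one, add_comm (n₀ * k)]
      refine h1.mono ?_
      have e : r ^ (k + 1) * K = r * (r ^ k * K) := by ring
      rw [e]
      exact mul_le_mul_of_nonneg_right (le_max_left _ _) (mul_nonneg (pow_nonneg hr0.le k) hK)
  -- The `n % n₀` leftover steps do not increase the constant; the factor `r⁻¹ = q ^ (-n₀)` pays for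
  -- them.
  have h1 := (hstep (n / n₀)).iterate_transfer (μ := μ)
    (measurable_iterate_transfer hf _) (n % n₀)
  rw [← Function.iterate_add_apply, Nat.mod_add_div] at h1
  refine h1.mono (mul_le_mul_of_nonneg_right ?_ hK)
  rw [le_inv_mul_iff₀ hr0]
  calc r * r ^ (n / n₀) = q ^ (n₀ * (n / n₀) + n₀) := by rw [pow_add, pow_mul, hqn]; ring
    _ ≤ q ^ n := pow_le_pow_of_le_one hq0.le hq1.le (by
      have h2 := Nat.mod_add_div n n₀
      have h3 := Nat.mod_lt n hn₀
      omega)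

variable {C q : ℝ}

/-- Later iterates are averages of values of the earlier one, whose oscillation is at most `C q ^ n
K`. The sequence is thus Cauchy uniformly in the starting points, and no stationary measure has to
be constructed. -/
theorem GeomContract.exists_limit (hd : 1 ≤ d) (hc : GeomContract μ C q) {K : ℝ}
    {f : limitedCone d → ℝ} (hf : Measurable f) (h : ProjLip K f) :
    ∃ c, ∀ n x, |(transfer μ)^[n] f x - c| ≤ C * q ^ n * K := by
  obtain ⟨hC, hq, hq1, hcon⟩ := hc
  have key : ∀ n m, n ≤ m → ∀ x y,
      |(transfer μ)^[n] f x - (transfer μ)^[m] f y| ≤ C * q ^ n * K := by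
    intro n m hnm x y
    obtain ⟨k, rfl⟩ := Nat.exists_eq_add_of_le' hnm
    rw [Function.iterate_add_apply _ k n]
    exact abs_sub_iterate_transfer_le (measurable_iterate_transfer hf n)
      (fun z => (hcon K f hf h n).abs_sub_le x z) k y
  have hlim : Tendsto (fun n => C * q ^ n * K) atTop (𝓝 0) := by
    simpa using ((tendsto_pow_atTop_nhds_zero_of_lt_one hq.le hq1).const_mul C).mul_const K
  have x₀ := barycentre hd
  obtain ⟨c, hc⟩ := cauchySeq_tendsto_of_complete (cauchySeq_of_le_tendsto_0'
    (s := fun n => (transfer μ)^[n] f x₀) _ (fun n m hnm => key n m hnm x₀ x₀) hlim)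
  refine ⟨c, fun n x => ?_⟩
  refine le_of_tendsto ((tendsto_const_nhds.sub hc).abs) ?_
  filter_upwards [eventually_ge_atTop n] with m hm using key n m hm x x₀

/-- The solution is `θ = ∑ P^n f`; the single majorant `∑ C q ^ n K` controls both its supremum and
its Lipschitz constant. -/
theorem GeomContract.exists_poisson (hc : GeomContract μ C q) {K : ℝ}
    {f : limitedCone d → ℝ} (hf : Measurable f) (h : ProjLip K f)
    (h0 : ∀ n x, |(transfer μ)^[n] f x| ≤ C * q ^ n * K) :
    ∃ (θ : limitedCone d → ℝ) (B : ℝ), Measurable θ ∧ ProjLip B θ ∧ (∀ x, |θ x| ≤ B) ∧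
      ∀ x, θ x = f x + transfer μ θ x := by
  obtain ⟨hC, hq, hq1, hcon⟩ := hc
  have hg : Summable fun n => C * q ^ n * K :=
    ((summable_geometric_of_lt_one hq.le hq1).mul_left C).mul_right K
  have hs : ∀ x, Summable fun n => (transfer μ)^[n] f x := fun x =>
    .of_norm_bounded hg fun n => h0 n x
  have hm := fun n => measurable_iterate_transfer (μ := μ) hf n
  refine ⟨fun x => ∑' n, (transfer μ)^[n] f x, ∑' n, C * q ^ n * K, ?_, ?_, ?_, ?_⟩
  · refine measurable_of_tendsto_metrizable (f := fun n x =>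
      ∑ k ∈ Finset.range n, (transfer μ)^[k] f x)
      (fun n => Finset.measurable_sum _ fun k _ => hm k) ?_
    exact tendsto_pi_nhds.2 fun x => (hs x).hasSum.tendsto_sum_nat
  · intro x y α β hc
    rw [← (hs x).tsum_sub (hs y), ← tsum_mul_right]
    exact tsum_of_norm_bounded
      (f := fun n => (transfer μ)^[n] f x - (transfer μ)^[n] f y)
      (hg.mul_right (1 - α * β)).hasSum fun n => hcon K f hf h n x y α β hc
  · intro x
    exact tsum_of_norm_bounded (f := fun n => (transfer μ)^[n] f x) hg.hasSum fun n => h0 n x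
  · intro x
    have hi : ∀ n, Integrable (fun g => (transfer μ)^[n] f (act g x)) μ := fun n =>
      (hcon K f hf h n).integrable (hm n) x
    have h1 := integral_tsum_of_summable_integral_norm hi (by
      refine .of_nonneg_of_le (fun n => integral_nonneg fun g => norm_nonneg _) (fun n => ?_) hg
      calc _ ≤ ∫ _, C * q ^ n * K ∂μ :=
            integral_mono (hi n).norm (integrable_const _) fun g => h0 n (act g x)
        _ = _ := by simp)
    change ∑' n, (transfer μ)^[n] f x = _ + ∫ g, ∑' n, (transfer μ)^[n] f (act g x) ∂μ
    rw [← h1, (hs x).tsum_eq_zero_add]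
    congr 1
    refine tsum_congr fun n => ?_
    rw [Function.iterate_succ_apply']
    rfl

/-! ### The mean increment -/

omit [IsProbabilityMeasure μ] in
theorem memLp_log_N (hd : 1 ≤ d) (h1 : P1 μ) : MemLp (fun g => Real.log (N g)) 2 μ := by
  obtain ⟨δ, hδ, hi⟩ := h1
  rw [memLp_two_iff_integrable_sq measurable_log_N.aestronglyMeasurable]
  refine (hi.const_mul ((δ / 2)⁻¹ ^ 2)).mono'
    (measurable_log_N.pow_const 2).aestronglyMeasurable (ae_of_all _ fun g => ?_)
  have hN : 0 < N g := zero_lt_one.trans_le (one_le_N hd g)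
  -- A logarithm is dominated by any power; the exponent `δ/2` is chosen so that the square is `N ^
  -- δ`.
  have h1 := Real.log_le_rpow_div hN.le (half_pos hδ)
  have h2 : N g ^ δ = (N g ^ (δ / 2)) ^ 2 := by
    rw [← Real.rpow_natCast, ← Real.rpow_mul hN.le]; norm_num
  rw [Real.norm_of_nonneg (sq_nonneg _), h2, ← mul_pow]
  refine pow_le_pow_left₀ (log_N_nonneg hd g) (h1.trans (le_of_eq ?_)) 2
  rw [div_eq_inv_mul]

theorem integrable_log_N (hd : 1 ≤ d) (h1 : P1 μ) : Integrable (fun g => Real.log (N g)) μ :=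
  (memLp_log_N hd h1).integrable (by norm_num)

theorem integrable_rho (hd : 1 ≤ d) (h1 : P1 μ) (x : limitedCone d) :
    Integrable (fun g => rho g x) μ :=
  (integrable_log_N hd h1).mono' (measurable_rho_left x).aestronglyMeasurable
    (ae_of_all _ fun g => abs_rho_le hd g x)

/-- The mean increment `∫ ρ(g, x) μ(dg)`. -/
def meanRho (μ : Measure (S d)) (x : limitedCone d) : ℝ := ∫ g, rho g x ∂μ

theorem measurable_meanRho : Measurable (meanRho μ) := by
  have h : StronglyMeasurable fun p : limitedCone d × S d => rho p.2 p.1 :=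
    (measurable_rho.comp measurable_swap).stronglyMeasurable
  exact (h.integral_prod_right (ν := μ)).measurable

theorem projLip_meanRho (hd : 1 ≤ d) (h1 : P1 μ) :
    ProjLip (∫ g, (2 + 4 * Real.log (N g)) ∂μ) (meanRho μ) := by
  intro x y α β hc
  rw [meanRho, meanRho, ← integral_sub (integrable_rho hd h1 x) (integrable_rho hd h1 y),
    ← integral_mul_const]
  refine abs_integral_le_integral_abs.trans (integral_mono
    ((integrable_rho hd h1 x).sub (integrable_rho hd h1 y)).abs ?_
    fun g => hc.abs_rho_sub_le hd g)
  exact ((integrable_const _).add ((integrable_log_N hd h1).const_mul 4)).mul_const _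

theorem integrable_convPow_rho (hd : 1 ≤ d) (h1 : P1 μ) (n : ℕ) (x : limitedCone d) :
    Integrable (fun g => rho g x) (convPow μ n) := by
  induction n with
  | zero =>
    rw [convPow]
    exact integrable_dirac (by simp)
  | succ n ih =>
    rw [integrable_convPow_succ (measurable_rho_left x)]
    refine (((integrable_log_N hd h1).comp_fst (convPow μ n)).add
      ((ih.norm).comp_snd μ)).mono'
      ((measurable_rho_left x).comp measurable_mul).aestronglyMeasurable
      (ae_of_all _ fun p => ?_)
    rw [rho_mul]
    exact (norm_add_le _ _).trans (add_le_add_left (abs_rho_le hd _ _) _)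

/-- By the cocycle relation, each new factor adds the mean increment at the current position of the
chain. -/
theorem integral_convPow_rho (hd : 1 ≤ d) (h1 : P1 μ) (n : ℕ) (x : limitedCone d) :
    ∫ g, rho g x ∂(convPow μ n) = ∑ k ∈ Finset.range n, (transfer μ)^[k] (meanRho μ) x := by
  induction n with
  | zero => simp [convPow, rho_one]
  | succ n ih =>
    have hl := projLip_meanRho hd h1
    rw [integral_convPow_succ (measurable_rho_left x) (integrable_convPow_rho hd h1 (n + 1) x),
      Finset.sum_range_succ, ← ih, ← transfer_convPow n measurable_meanRho hl, transfer, add_comm,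
      ← integral_add (hl.integrable measurable_meanRho x) (integrable_convPow_rho hd h1 n x)]
    refine integral_congr_ae (ae_of_all _ fun h => ?_)
    simp only [rho_mul]
    rw [integral_add (integrable_rho hd h1 _) (integrable_const _)]
    simp [meanRho]

theorem GeomContract.abs_iterate_meanRho_le (hd : 1 ≤ d) (hc : GeomContract μ C q) (h1 : P1 μ)
    (h4 : P4 μ) (n : ℕ) (x : limitedCone d) :
    |(transfer μ)^[n] (meanRho μ) x| ≤ C * q ^ n * ∫ g, (2 + 4 * Real.log (N g)) ∂μ := by
  obtain ⟨c, hlim⟩ := hc.exists_limit hd measurable_meanRho (projLip_meanRho hd h1)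
  suffices hc0 : c = 0 by simpa [hc0] using hlim n x
  obtain ⟨hC, hq, hq1, -⟩ := hc
  set b := barycentre hd
  have t1 : Tendsto (fun n => (transfer μ)^[n] (meanRho μ) b) atTop (𝓝 c) := by
    rw [tendsto_iff_dist_tendsto_zero]
    refine squeeze_zero (fun _ => dist_nonneg) (fun n => hlim n b) ?_
    simpa using ((tendsto_pow_atTop_nhds_zero_of_lt_one hq.le hq1).const_mul C).mul_const _
  have t2 := t1.cesaro
  have t3 : Tendsto (fun n : ℕ => (n : ℝ)⁻¹ * Real.log d) atTop (𝓝 0) := by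
    simpa using tendsto_inv_atTop_nhds_zero_nat.mul_const (Real.log d)
  -- The Cesàro means of `P^k (meanRho μ)` tend to `c` and differ from `n⁻¹ 𝔼 log |g_n ⋯ g_1|` by at
  -- most `n⁻¹ log d`; so `c` is the Lyapunov exponent.
  have t4 : Tendsto (fun n : ℕ => (n : ℝ)⁻¹ * ∫ g, Real.log (colMax g) ∂(convPow μ n) -
      (n : ℝ)⁻¹ * ∑ k ∈ Finset.range n, (transfer μ)^[k] (meanRho μ) b) atTop (𝓝 0) := by
    refine squeeze_zero_norm (fun n => ?_) t3
    have hi := integrable_convPow_rho hd h1 n b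
    have hd' : Integrable (fun g => Real.log (colMax g) - rho g b) (convPow μ n) :=
      .of_bound ((Real.measurable_log.comp measurable_colMax).sub
        (measurable_rho_left b)).aestronglyMeasurable (Real.log d)
        (ae_of_all _ fun g => abs_log_colMax_sub_rho_le hd g)
    have hi' : Integrable (fun g => Real.log (colMax g)) (convPow μ n) := by
      exact (hd'.add hi).congr (ae_of_all _ fun g => by simp)
    rw [← mul_sub, ← integral_convPow_rho hd h1, ← integral_sub hi' hi, norm_mul,
      Real.norm_of_nonneg (by positivity)]
    refine mul_le_mul_of_nonneg_left ?_ (by positivity)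
    simpa using norm_integral_le_of_norm_le_const (μ := convPow μ n)
      (f := fun g => Real.log (colMax g) - rho g b)
      (ae_of_all _ fun g => abs_log_colMax_sub_rho_le hd g)
  have t5 : Tendsto _ _ _ := h4
  have := tendsto_nhds_unique t4 (t5.sub t2)
  linarith

/-! ### The martingale increments -/

/-- The increment `ρ(g, y) + θ(g · y) - θ(y)` of the cocycle corrected by the coboundary
of `θ`. -/
def corrected (θ : limitedCone d → ℝ) (p : limitedCone d × S d) : ℝ :=
  rho p.2 p.1 + θ (act p.2 p.1) - θ p.1

/-- The mean square of the corrected increment. -/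
def meanSq (μ : Measure (S d)) (θ : limitedCone d → ℝ) (y : limitedCone d) : ℝ :=
  ∫ g, corrected θ (y, g) ^ 2 ∂μ

variable {θ : limitedCone d → ℝ} {B : ℝ}

theorem measurable_corrected (hθ : Measurable θ) : Measurable (corrected θ) :=
  ((measurable_rho.comp measurable_swap).add (hθ.comp (measurable_act.comp measurable_swap))).sub
    (hθ.comp measurable_fst)

theorem abs_corrected_le (hd : 1 ≤ d) (hB : ∀ x, |θ x| ≤ B) (p : limitedCone d × S d) :
    |corrected θ p| ≤ Real.log (N p.2) + 2 * B := by
  have h1 := abs_rho_le hd p.2 p.1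
  have h2 := hB (act p.2 p.1)
  have h3 := hB p.1
  rw [abs_le] at *
  unfold corrected
  constructor <;> linarith

theorem memLp_bound (hd : 1 ≤ d) (h1 : P1 μ) (B : ℝ) :
    MemLp (fun g => Real.log (N g) + B) 2 μ := (memLp_log_N hd h1).add (memLp_const B)

theorem memLp_corrected (hd : 1 ≤ d) (h1 : P1 μ) (hθ : Measurable θ) (hB : ∀ x, |θ x| ≤ B)
    (y : limitedCone d) : MemLp (fun g => corrected θ (y, g)) 2 μ :=
  (memLp_bound hd h1 (2 * B)).mono'
    ((measurable_corrected hθ).comp (measurable_const.prodMk measurable_id)).aestronglyMeasurable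
    (ae_of_all _ fun g => abs_corrected_le hd hB (y, g))

/-- This is the Poisson equation rewritten, and it makes the corrected increments martingale
differences. -/
theorem integral_corrected (hd : 1 ≤ d) (h1 : P1 μ) (hθ : Measurable θ) (hB : ∀ x, |θ x| ≤ B)
    (heq : ∀ x, θ x = meanRho μ x + transfer μ θ x) (y : limitedCone d) :
    ∫ g, corrected θ (y, g) ∂μ = 0 := by
  have hi := integrable_comp_act_of_bound (ν := μ) hθ hB y
  simp only [corrected]
  rw [integral_sub (f := fun g => rho g y + θ (act g y)) ((integrable_rho hd h1 y).add hi)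
      (integrable_const _), integral_add (integrable_rho hd h1 y) hi, integral_const]
  have := heq y
  simp only [meanRho, transfer] at this
  simp [this]

theorem measurable_meanSq (hθ : Measurable θ) : Measurable (meanSq μ θ) := by
  have h : StronglyMeasurable fun p : limitedCone d × S d => corrected θ p ^ 2 :=
    ((measurable_corrected hθ).pow_const 2).stronglyMeasurable
  exact (h.integral_prod_right (ν := μ)).measurable

/-- Factor the difference of squares: the difference carries `1 - α β`, and both factors are affine
in `log N(g)`, so the second moment of `log N` gives a finite constant. -/
theorem exists_projLip_meanSq (hd : 1 ≤ d) (h1 : P1 μ) (hθ : Measurable θ)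
    (hB : ∀ x, |θ x| ≤ B) (hl : ProjLip B θ) : ∃ K, ProjLip K (meanSq μ θ) := by
  set M : S d → ℝ := fun g => (4 * (Real.log (N g) + (1 + B) / 2)) * (2 * (Real.log (N g) + 2 * B))
  have hM : Integrable M μ :=
    MemLp.integrable_mul (p := 2) (q := 2)
      ((memLp_bound hd h1 ((1 + B) / 2)).const_mul 4) ((memLp_bound hd h1 (2 * B)).const_mul 2)
  refine ⟨∫ g, M g ∂μ, fun x y α β hc => ?_⟩
  have hx := (memLp_corrected hd h1 hθ hB x).integrable_sq
  have hy := (memLp_corrected hd h1 hθ hB y).integrable_sq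
  rw [meanSq, meanSq, ← integral_sub hx hy, ← integral_mul_const]
  refine abs_integral_le_integral_abs.trans (integral_mono (hx.sub hy).abs (hM.mul_const _)
    fun g => ?_)
  have hD := sub_nonneg.2 hc.mul_le_one
  have e1 : |corrected θ (x, g) - corrected θ (y, g)| ≤
      (2 + 4 * Real.log (N g) + 2 * B) * (1 - α * β) := by
    obtain ⟨α', β', e, hc'⟩ := hc.act g
    have h2 := hl _ _ _ _ hc'
    have h3 := hl _ _ _ _ hc
    have h4 := hc.abs_rho_sub_le hd g
    rw [e] at h2
    rw [abs_le] at *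
    simp only [corrected]
    constructor <;> linarith
  have e2 : |corrected θ (x, g) + corrected θ (y, g)| ≤ 2 * (Real.log (N g) + 2 * B) := by
    have h2 := abs_corrected_le hd hB (x, g)
    have h3 := abs_corrected_le hd hB (y, g)
    refine (abs_add_le _ _).trans ?_
    simp only at h2 h3
    linarith
  calc |corrected θ (x, g) ^ 2 - corrected θ (y, g) ^ 2|
      = |corrected θ (x, g) - corrected θ (y, g)| * |corrected θ (x, g) + corrected θ (y, g)| := by
        rw [← abs_mul]; ring_nf
    _ ≤ (2 + 4 * Real.log (N g) + 2 * B) * (1 - α * β) * (2 * (Real.log (N g) + 2 * B)) :=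
        mul_le_mul e1 e2 (abs_nonneg _) ((abs_nonneg _).trans e1)
    _ = _ := by simp only [M]; ring

end ConvPow

/-! ### The Markov chain -/

theorem measurable_comp_act {f : limitedCone d → ℝ} (hf : Measurable f) :
    Measurable fun p : limitedCone d × S d => f (act p.2 p.1) := by
  have h := Measurable.comp (g := fun p : S d × limitedCone d => act p.1 p.2)
    (f := fun p : limitedCone d × S d => p.swap) measurable_act measurable_swap
  have h' := hf.comp h
  exact h'

section Chain

variable {Ω : Type*} [mΩ : MeasurableSpace Ω] {g : ℕ → Ω → S d} {x : limitedCone d}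

/-- The σ-algebra generated by `g_0, …, g_k`. -/
@[reducible]
def hist (g : ℕ → Ω → S d) (k : ℕ) : MeasurableSpace Ω :=
  ⨆ j ∈ Set.Iic k, MeasurableSpace.comap (g j) inferInstance

omit mΩ in
theorem hist_mono {k l : ℕ} (h : k ≤ l) : hist g k ≤ hist g l :=
  biSup_mono fun _ hj => le_trans hj h

theorem hist_le (hg : ∀ n, Measurable (g n)) (k : ℕ) : hist g k ≤ mΩ :=
  iSup₂_le fun j _ => (hg j).comap_le

omit mΩ in
theorem measurable_hist (k : ℕ) : Measurable[hist g k] (g k) := by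
  rw [measurable_iff_comap_le]
  exact le_biSup (fun j => MeasurableSpace.comap (g j) inferInstance) (Set.mem_Iic.2 le_rfl)

omit mΩ in
theorem X_zero (ω : Ω) : X g x 0 ω = x := act_one x

omit mΩ in
theorem X_succ (k : ℕ) (ω : Ω) : X g x (k + 1) ω = act (g (k + 1) ω) (X g x k ω) :=
  act_mul _ _ _

omit mΩ in
theorem measurable_X_hist (k : ℕ) : Measurable[hist g k] (X g x k) := by
  induction k with
  | zero =>
    have : X g x 0 = fun _ => x := funext X_zero
    rw [this]
    exact measurable_const
  | succ k ih =>
    have : X g x (k + 1) = fun ω => act (g (k + 1) ω) (X g x k ω) := funext (X_succ k)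
    rw [this]
    have h1 := (measurable_hist (g := g) (k + 1)).prodMk (ih.mono (hist_mono k.le_succ) le_rfl)
    have h2 := Measurable.comp (g := fun p : S d × limitedCone d => act p.1 p.2)
      (f := fun ω => (g (k + 1) ω, X g x k ω)) measurable_act h1
    exact h2

variable {Pr : Measure Ω} [IsProbabilityMeasure Pr] {μ : Measure (S d)} [IsProbabilityMeasure μ]

omit [IsProbabilityMeasure Pr] in
theorem indepFun_of_measurable_hist (hg : ∀ n, Measurable (g n)) (hind : iIndepFun g Pr)
    {E : Type*} [MeasurableSpace E] {W : Ω → E} {k : ℕ} (hW : Measurable[hist g k] W) :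
    IndepFun W (g (k + 1)) Pr := by
  rw [IndepFun_iff_Indep]
  have h := indep_iSup_of_disjoint (fun n => (hg n).comap_le)
    ((iIndepFun_iff_iIndep _ _ _).1 hind) (S := Set.Iic k) (T := {k + 1}) (by simp)
  simp only [Set.mem_singleton_iff, iSup_iSup_eq_left] at h
  exact indep_of_indep_of_le_left h hW.comap_le

/-- The `g_n` are independent with common law `μ`. -/
structure IsIIDSeq (g : ℕ → Ω → S d) (Pr : Measure Ω) (μ : Measure (S d)) : Prop where
  meas : ∀ n, Measurable (g n)
  indep : iIndepFun g Pr
  law : ∀ n, Measure.map (g n) Pr = μ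

variable (hg : IsIIDSeq g Pr μ)
include hg

omit [IsProbabilityMeasure Pr] [IsProbabilityMeasure μ] in
theorem IsIIDSeq.measurable_X (k : ℕ) : Measurable (X g x k) :=
  (measurable_X_hist k).mono (hist_le hg.meas k) le_rfl

/-- The Markov property. -/
theorem IsIIDSeq.integral_markov {k : ℕ} {U : Ω → ℝ} (hU : Measurable[hist g k] U)
    {F : limitedCone d × S d → ℝ} (hF : Measurable F)
    (hi : Integrable (fun ω => U ω * F (X g x k ω, g (k + 1) ω)) Pr) :
    ∫ ω, U ω * F (X g x k ω, g (k + 1) ω) ∂Pr = ∫ ω, U ω * ∫ s, F (X g x k ω, s) ∂μ ∂Pr := by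
  have hU' : Measurable U := hU.mono (hist_le hg.meas k) le_rfl
  have hW' : Measurable fun ω => (U ω, X g x k ω) := hU'.prodMk (hg.measurable_X k)
  have hind := indepFun_of_measurable_hist hg.meas hg.indep
    (hU.prodMk (measurable_X_hist (g := g) (x := x) k))
  have hmap := (indepFun_iff_map_prod_eq_prod_map_map hW'.aemeasurable
    (hg.meas (k + 1)).aemeasurable).1 hind
  -- The joint law of `((U, X_k), g_{k+1})` is now a product with second factor `μ`, and Fubini
  -- applies.
  rw [hg.law] at hmap
  set Φ : (ℝ × limitedCone d) × S d → ℝ := fun p => p.1.1 * F (p.1.2, p.2)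
  have hΦ : Measurable Φ := by
    refine (measurable_fst.comp measurable_fst).mul (hF.comp ?_)
    exact (measurable_snd.comp measurable_fst).prodMk measurable_snd
  have hm : Measurable fun ω => ((U ω, X g x k ω), g (k + 1) ω) := hW'.prodMk (hg.meas _)
  have hi' : Integrable Φ (Measure.map (fun ω => ((U ω, X g x k ω), g (k + 1) ω)) Pr) :=
    (integrable_map_measure hΦ.aestronglyMeasurable hm.aemeasurable).2 hi
  have h1 := integral_map (μ := Pr) hm.aemeasurable hΦ.aestronglyMeasurable
  rw [hmap] at h1 hi'
  have h2 : Measurable fun w : ℝ × limitedCone d => ∫ s, Φ (w, s) ∂μ :=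
    (hΦ.stronglyMeasurable.integral_prod_right (ν := μ)).measurable
  have h3 := integral_map (μ := Pr) hW'.aemeasurable h2.aestronglyMeasurable
  rw [integral_prod _ hi', h3] at h1
  simp only [Φ, integral_const_mul] at h1
  exact h1.symm

theorem IsIIDSeq.integral_comp_X {f : limitedCone d → ℝ} (hf : Measurable f) {B : ℝ}
    (hB : ∀ x, |f x| ≤ B) (k : ℕ) :
    ∫ ω, f (X g x k ω) ∂Pr = (transfer μ)^[k] f x := by
  induction k generalizing f with
  | zero => simp [X_zero]
  | succ k ih =>
    have hb : ∀ y, |transfer μ f y| ≤ B := fun y => by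
      simpa using abs_sub_transfer_le (ν := μ) hf (a := 0) (by simpa using hB) y
    rw [Function.iterate_succ_apply, ← ih (measurable_transfer hf) hb]
    have h := hg.integral_markov (x := x) (k := k) (U := fun _ => 1) measurable_const
      (F := fun p => f (act p.2 p.1)) (measurable_comp_act hf) (by
        simp only [one_mul, ← X_succ]
        exact .of_bound (hf.comp (hg.measurable_X (k + 1))).aestronglyMeasurable B
          (ae_of_all _ fun _ => hB _))
    simp only [one_mul, ← X_succ] at h
    exact h

omit hg in
/-- The martingale difference `a_{k+1} + θ(X_{k+1}) - θ(X_k)`. -/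
def mdiff (g : ℕ → Ω → S d) (x : limitedCone d) (θ : limitedCone d → ℝ) (k : ℕ) (ω : Ω) : ℝ :=
  corrected θ (X g x k ω, g (k + 1) ω)

omit hg in
/-- The martingale sum of the `n` differences following time `j`. -/
def msum (g : ℕ → Ω → S d) (x : limitedCone d) (θ : limitedCone d → ℝ) (j n : ℕ) (ω : Ω) : ℝ :=
  ∑ k ∈ Finset.range n, mdiff g x θ (j + k) ω

variable {θ : limitedCone d → ℝ} {B : ℝ}

omit hg mΩ in
theorem mdiff_eq (k : ℕ) (ω : Ω) :
    mdiff g x θ k ω = a g x (k + 1) ω + θ (X g x (k + 1) ω) - θ (X g x k ω) := by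
  rw [X_succ]; rfl

omit hg mΩ in
theorem msum_succ (j n : ℕ) (ω : Ω) :
    msum g x θ j (n + 1) ω = msum g x θ j n ω + mdiff g x θ (j + n) ω :=
  Finset.sum_range_succ _ _

omit hg mΩ in
-- The coboundary telescopes; the increments are those of times `j + 1, …, j + n`.
theorem msum_eq (j n : ℕ) (ω : Ω) :
    msum g x θ j n ω = ∑ k ∈ Finset.range n, a g x (j + k + 1) ω +
      (θ (X g x (j + n) ω) - θ (X g x j ω)) := by
  induction n with
  | zero => simp [msum]
  | succ n ih => rw [msum_succ, ih, mdiff_eq, Finset.sum_range_succ, ← add_assoc j]; ring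

omit hg mΩ in
theorem measurable_mdiff_hist (hθ : Measurable θ) (k : ℕ) :
    Measurable[hist g (k + 1)] (mdiff g x θ k) :=
  (measurable_corrected hθ).comp
    (((measurable_X_hist k).mono (hist_mono k.le_succ) le_rfl).prodMk (measurable_hist (k + 1)))

omit hg mΩ in
theorem measurable_msum_hist (hθ : Measurable θ) (j n : ℕ) :
    Measurable[hist g (j + n)] (msum g x θ j n) := by
  refine Finset.measurable_sum _ fun k hk => ?_
  refine (measurable_mdiff_hist hθ (j + k)).mono (hist_mono ?_) le_rfl
  have := Finset.mem_range.1 hk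
  omega

omit [IsProbabilityMeasure Pr] [IsProbabilityMeasure μ] in
theorem IsIIDSeq.memLp_comp {F : S d → ℝ} (hF : MemLp F 2 μ) (k : ℕ) :
    MemLp (fun ω => F (g k ω)) 2 Pr :=
  hF.comp_measurePreserving ⟨hg.meas k, hg.law k⟩

omit [IsProbabilityMeasure Pr] in
theorem IsIIDSeq.memLp_mdiff (hd : 1 ≤ d) (h1 : P1 μ) (hθ : Measurable θ) (hB : ∀ x, |θ x| ≤ B)
    (k : ℕ) : MemLp (mdiff g x θ k) 2 Pr :=
  (hg.memLp_comp (memLp_bound hd h1 (2 * B)) (k + 1)).mono'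
    ((measurable_mdiff_hist hθ k).mono (hist_le hg.meas _) le_rfl).aestronglyMeasurable
    (ae_of_all _ fun _ => abs_corrected_le hd hB _)

omit [IsProbabilityMeasure Pr] in
theorem IsIIDSeq.memLp_msum (hd : 1 ≤ d) (h1 : P1 μ) (hθ : Measurable θ) (hB : ∀ x, |θ x| ≤ B)
    (j n : ℕ) : MemLp (msum g x θ j n) 2 Pr :=
  memLp_finsetSum _ fun k _ => hg.memLp_mdiff hd h1 hθ hB (j + k)

omit [IsProbabilityMeasure μ] in
theorem IsIIDSeq.memLp_comp_X {f : limitedCone d → ℝ} (hf : Measurable f) {B' : ℝ}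
    (hB' : ∀ x, |f x| ≤ B') (k : ℕ) : MemLp (fun ω => f (X g x k ω)) 2 Pr :=
  .of_bound (hf.comp (hg.measurable_X k)).aestronglyMeasurable B' (ae_of_all _ fun _ => hB' _)

theorem IsIIDSeq.integral_abs_mdiff_le (hd : 1 ≤ d) (h1 : P1 μ) (hθ : Measurable θ)
    (hB : ∀ x, |θ x| ≤ B) (k : ℕ) :
    ∫ ω, |mdiff g x θ k ω| ∂Pr ≤ ∫ s, (Real.log (N s) + 2 * B) ∂μ := by
  have h2 := integral_map (μ := Pr) (hg.meas (k + 1)).aemeasurable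
    (f := fun s => Real.log (N s) + 2 * B)
    (measurable_log_N.add measurable_const).aestronglyMeasurable
  rw [hg.law] at h2
  rw [h2]
  exact integral_mono ((hg.memLp_mdiff hd h1 hθ hB k).integrable (by norm_num)).abs
    ((hg.memLp_comp (memLp_bound hd h1 (2 * B)) (k + 1)).integrable (by norm_num))
    fun _ => abs_corrected_le hd hB _

/-! ### Orthogonality, correlation with the endpoint, and the lower bound -/

section Martingale

variable (hd : 1 ≤ d) (h1 : P1 μ) (hθ : Measurable θ) (hB : ∀ x, |θ x| ≤ B)
include hd h1 hθ hB

section Centered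

variable (heq : ∀ x, θ x = meanRho μ x + transfer μ θ x)
include heq

theorem IsIIDSeq.integral_mul_mdiff {k : ℕ} {U : Ω → ℝ} (hU : Measurable[hist g k] U)
    (hU2 : MemLp U 2 Pr) : ∫ ω, U ω * mdiff g x θ k ω ∂Pr = 0 := by
  have h := hg.integral_markov (x := x) hU (measurable_corrected hθ)
    (hU2.integrable_mul (hg.memLp_mdiff hd h1 hθ hB k))
  simp only [integral_corrected hd h1 hθ hB heq, mul_zero, integral_zero] at h
  exact h

theorem IsIIDSeq.integral_mdiff (k : ℕ) : ∫ ω, mdiff g x θ k ω ∂Pr = 0 := by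
  simpa using hg.integral_mul_mdiff hd h1 hθ hB heq (x := x) (k := k) (U := fun _ => 1)
    measurable_const (memLp_const 1)

theorem IsIIDSeq.integral_msum (j n : ℕ) : ∫ ω, msum g x θ j n ω ∂Pr = 0 := by
  simp only [msum]
  rw [integral_finsetSum _ fun k _ =>
    (hg.memLp_mdiff hd h1 hθ hB (j + k)).integrable (by norm_num)]
  exact Finset.sum_eq_zero fun k _ => hg.integral_mdiff hd h1 hθ hB heq (j + k)

/-- Pythagoras for martingale differences: cross terms vanish, and by the Markov property each
square has mean `meanSq` at the current position. -/
theorem IsIIDSeq.integral_msum_sq (j n : ℕ) {B' : ℝ} (hB' : ∀ y, |meanSq μ θ y| ≤ B') :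
    ∫ ω, msum g x θ j n ω ^ 2 ∂Pr =
      ∑ k ∈ Finset.range n, (transfer μ)^[j + k] (meanSq μ θ) x := by
  induction n with
  | zero => simp [msum]
  | succ n ih =>
    have m1 := hg.memLp_msum hd h1 hθ hB (x := x) j n
    have m2 := hg.memLp_mdiff hd h1 hθ hB (x := x) (j + n)
    have i1 := m1.integrable_sq
    have i2 := m2.integrable_sq
    have i3 : Integrable (fun ω => msum g x θ j n ω * mdiff g x θ (j + n) ω) Pr :=
      m1.integrable_mul m2
    have e1 := hg.integral_mul_mdiff hd h1 hθ hB heq (x := x) (measurable_msum_hist hθ j n) m1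
    have e2 : ∫ ω, mdiff g x θ (j + n) ω ^ 2 ∂Pr = ∫ ω, meanSq μ θ (X g x (j + n) ω) ∂Pr := by
      have h := hg.integral_markov (x := x) (k := j + n) (U := fun _ => 1) measurable_const
        (F := fun p => corrected θ p ^ 2) ((measurable_corrected hθ).pow_const 2)
        (by simp only [one_mul]; exact i2)
      simp only [one_mul] at h
      exact h
    rw [hg.integral_comp_X (measurable_meanSq hθ) hB'] at e2
    rw [Finset.sum_range_succ, ← ih, ← e2, ← integral_add i1 i2]
    have e3 : ∀ ω, msum g x θ j (n + 1) ω ^ 2 = msum g x θ j n ω ^ 2 + mdiff g x θ (j + n) ω ^ 2 +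
        2 * (msum g x θ j n ω * mdiff g x θ (j + n) ω) := fun ω => by rw [msum_succ]; ring
    simp only [e3]
    rw [integral_add (f := fun ω => msum g x θ j n ω ^ 2 + mdiff g x θ (j + n) ω ^ 2)
      (i1.add i2) (i3.const_mul 2), integral_const_mul, e1]
    simp

theorem IsIIDSeq.integral_msum_mul_start (j n : ℕ) {f : limitedCone d → ℝ} (hf : Measurable f)
    {B' : ℝ} (hB' : ∀ y, |f y| ≤ B') :
    ∫ ω, msum g x θ j n ω * f (X g x j ω) ∂Pr = 0 := by
  have m1 := hg.memLp_comp_X (x := x) hf hB' j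
  simp only [msum, Finset.sum_mul]
  have hi : ∀ k, Integrable (fun ω => mdiff g x θ (j + k) ω * f (X g x j ω)) Pr := fun k =>
    (hg.memLp_mdiff hd h1 hθ hB (j + k)).integrable_mul m1
  rw [integral_finsetSum _ fun k _ => hi k]
  refine Finset.sum_eq_zero fun k _ => ?_
  simp only [mul_comm _ (f _)]
  exact hg.integral_mul_mdiff hd h1 hθ hB heq
    ((hf.comp (measurable_X_hist j)).mono (hist_mono (Nat.le_add_right j k)) le_rfl) m1

/-- Seen from `i` further steps before the end, `f` of the endpoint becomes `P^i f`, with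
oscillation at most `b i`. A centred difference only sees this oscillation, so the correlations are
summable when `b` is. -/
theorem IsIIDSeq.abs_integral_msum_mul_end_le (j n : ℕ) {f : limitedCone d → ℝ}
    (hf : Measurable f) {B' : ℝ} (hB' : ∀ y, |f y| ≤ B') {b : ℕ → ℝ}
    (hb : ∀ i y z, |(transfer μ)^[i] f y - (transfer μ)^[i] f z| ≤ b i) :
    |∫ ω, msum g x θ j n ω * f (X g x (j + n) ω) ∂Pr| ≤
      (∫ s, (Real.log (N s) + 2 * B) ∂μ) * ∑ i ∈ Finset.range n, b i := by
  induction n generalizing f b with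
  | zero => simp [msum]
  | succ n ih =>
    have hb' : ∀ y, |transfer μ f y| ≤ B' := fun y => by
      simpa using abs_sub_transfer_le (ν := μ) hf (a := 0) (by simpa using hB') y
    have m1 := hg.memLp_msum hd h1 hθ hB (x := x) j n
    have m2 := hg.memLp_mdiff hd h1 hθ hB (x := x) (j + n)
    have m3 := hg.memLp_comp_X (x := x) hf hB' (j + n + 1)
    have i1 : Integrable (fun ω => msum g x θ j n ω * f (X g x (j + n + 1) ω)) Pr :=
      m1.integrable_mul m3
    have i2 : Integrable (fun ω => mdiff g x θ (j + n) ω * f (X g x (j + n + 1) ω)) Pr :=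
      m2.integrable_mul m3
    have e1 : ∫ ω, msum g x θ j n ω * f (X g x (j + n + 1) ω) ∂Pr =
        ∫ ω, msum g x θ j n ω * transfer μ f (X g x (j + n) ω) ∂Pr := by
      have h := hg.integral_markov (x := x) (k := j + n) (measurable_msum_hist hθ j n)
        (F := fun p => f (act p.2 p.1)) (measurable_comp_act hf)
        (by simp only [← X_succ]; exact i1)
      simp only [← X_succ] at h
      exact h
    -- Conditioning on the past has replaced `f` by `P f`, which shifts the oscillation bounds by
    -- one.
    have e2 := ih (measurable_transfer hf) hb' (b := fun i => b (i + 1)) fun i => hb (i + 1)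
    have e3 : |∫ ω, mdiff g x θ (j + n) ω * f (X g x (j + n + 1) ω) ∂Pr| ≤
        (∫ s, (Real.log (N s) + 2 * B) ∂μ) * b 0 := by
      have i3 := m2.integrable (by norm_num : (1 : ENNReal) ≤ 2)
      -- Since the difference is centred, the constant `f x` may be subtracted, leaving only the
      -- oscillation of `f`.
      have e4 : ∫ ω, mdiff g x θ (j + n) ω * f (X g x (j + n + 1) ω) ∂Pr =
          ∫ ω, mdiff g x θ (j + n) ω * (f (X g x (j + n + 1) ω) - f x) ∂Pr := by
        simp only [mul_sub]
        rw [integral_sub i2 (i3.mul_const _), integral_mul_const,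
          hg.integral_mdiff hd h1 hθ hB heq]
        simp
      rw [e4]
      have hb0 : 0 ≤ b 0 := (abs_nonneg _).trans (hb 0 x x)
      refine le_trans ?_ (mul_le_mul_of_nonneg_right
        (hg.integral_abs_mdiff_le hd h1 hθ hB (x := x) (j + n)) hb0)
      rw [← integral_mul_const]
      refine abs_integral_le_integral_abs.trans (integral_mono_of_nonneg
        (ae_of_all _ fun _ => abs_nonneg _) (i3.abs.mul_const _) (ae_of_all _ fun ω => ?_))
      simp only [abs_mul]
      exact mul_le_mul_of_nonneg_left (hb 0 _ _) (abs_nonneg _)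
    rw [Finset.sum_range_succ', mul_add, ← add_assoc]
    simp only [msum_succ, add_mul]
    rw [integral_add i1 i2, e1]
    exact (abs_add_le _ _).trans (add_le_add e2 e3)

end Centered

/-- If `g_{j+1}, …, g_{j+n}` are all expanding, the increments sum to at least `n δ` and the
coboundary removes at most `2B`, so the martingale sum is at least `1`. The bound does not depend on
`j`. -/
theorem IsIIDSeq.pow_le_integral_msum_sq {δ : ℝ} {n : ℕ} (hn : 1 ≤ n * δ - 2 * B) (j : ℕ) :
    μ.real {s | ∀ y : limitedCone d, δ ≤ Real.log (l1 (lin s y))} ^ n ≤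
      ∫ ω, msum g x θ j n ω ^ 2 ∂Pr := by
  set G := {s : S d | ∀ y : limitedCone d, δ ≤ Real.log (l1 (lin s y))} with hG
  have hGm : MeasurableSet G := measurableSet_expanding δ
  set T := (Finset.range n).image fun k => j + k + 1
  have hinj : Function.Injective fun k => j + k + 1 := fun a b h => by
    simp only at h
    omega
  have hT : Pr (⋂ i ∈ T, g i ⁻¹' G) = μ G ^ n := by
    rw [hg.indep.measure_inter_preimage_eq_mul T fun _ _ => hGm]
    have : ∀ i ∈ T, Pr (g i ⁻¹' G) = μ G := fun i _ => by
      rw [← hg.law i, Measure.map_apply (hg.meas i) hGm]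
    rw [Finset.prod_congr rfl this, Finset.prod_const, Finset.card_image_of_injective _ hinj,
      Finset.card_range]
  have hTm : MeasurableSet (⋂ i ∈ T, g i ⁻¹' G) :=
    Finset.measurableSet_biInter _ fun i _ => hg.meas i hGm
  have e : μ.real G ^ n = ∫ ω, (⋂ i ∈ T, g i ⁻¹' G).indicator (fun _ => (1 : ℝ)) ω ∂Pr := by
    rw [integral_indicator_const _ hTm, Measure.real, Measure.real, hT]
    simp
  rw [e]
  refine integral_mono ((integrable_const _).indicator hTm)
    (hg.memLp_msum hd h1 hθ hB j n).integrable_sq fun ω => ?_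
  by_cases hω : ω ∈ ⋂ i ∈ T, g i ⁻¹' G
  · rw [Set.indicator_of_mem hω]
    have h2 : ∀ k ∈ Finset.range n, δ ≤ a g x (j + k + 1) ω := fun k hk =>
      Set.mem_iInter₂.1 hω (j + k + 1) (Finset.mem_image_of_mem _ hk) _
    have h3 := Finset.card_nsmul_le_sum _ _ _ h2
    rw [Finset.card_range, nsmul_eq_mul] at h3
    have h4 := abs_le.1 (hB (X g x (j + n) ω))
    have h5 := abs_le.1 (hB (X g x j ω))
    have h6 : 1 ≤ msum g x θ j n ω := by rw [msum_eq]; linarith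
    exact one_le_pow₀ h6
  · rw [Set.indicator_of_notMem hω]
    exact sq_nonneg _

end Martingale

omit [IsProbabilityMeasure Pr] [IsProbabilityMeasure μ] in
theorem IsIIDSeq.measurable_a (k : ℕ) : Measurable (a g x k) := by
  cases k with
  | zero => exact measurable_const
  | succ k =>
    exact Measurable.comp (g := fun p : S d × limitedCone d => rho p.1 p.2)
      (f := fun ω => (g (k + 1) ω, X g x k ω)) measurable_rho
      ((hg.meas (k + 1)).prodMk (hg.measurable_X k))

omit [IsProbabilityMeasure Pr] [IsProbabilityMeasure μ] in
theorem IsIIDSeq.memLp_a (hd : 1 ≤ d) (h1 : P1 μ) (k : ℕ) : MemLp (a g x k) 2 Pr := by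
  refine (hg.memLp_comp (memLp_log_N hd h1) k).mono' (hg.measurable_a k).aestronglyMeasurable
    (ae_of_all _ fun ω => ?_)
  cases k with
  | zero =>
    rw [a, rho_one, norm_zero]
    exact log_N_nonneg hd _
  | succ k => exact abs_rho_le hd _ _

omit [IsProbabilityMeasure Pr] [IsProbabilityMeasure μ] in
theorem IsIIDSeq.memLp_blockSum (hd : 1 ≤ d) (h1 : P1 μ) (m n : ℕ) :
    MemLp (blockSum g x m n) 2 Pr :=
  memLp_finsetSum _ fun k _ => hg.memLp_a hd h1 k

omit hg mΩ in
theorem blockSum_succ (m n : ℕ) (ω : Ω) :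
    blockSum g x (m + 1) n ω = ∑ k ∈ Finset.range n, a g x (m + k + 1) ω := by
  rw [blockSum, Finset.sum_Ico_eq_sum_range, Nat.add_sub_cancel_left]
  refine Finset.sum_congr rfl fun k _ => ?_
  congr 1
  omega

omit hg mΩ in
-- Because `a_0 = 0`, the time-zero term only lengthens the block.
theorem blockSum_zero_succ (n : ℕ) : blockSum g x 0 (n + 1) = blockSum g x 1 n := by
  ext ω
  rw [blockSum, blockSum, Finset.sum_eq_sum_Ico_succ_bot (by omega), a, rho_one, zero_add,
    zero_add, zero_add, add_comm 1 n]

end Chain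

/-! ### The variance estimate -/

theorem sum_geometric_le {q : ℝ} (hq : 0 < q) (hq1 : q < 1) (j n : ℕ) :
    ∑ k ∈ Finset.range n, q ^ (j + k) ≤ (1 - q)⁻¹ := by
  calc ∑ k ∈ Finset.range n, q ^ (j + k) ≤ ∑ k ∈ Finset.range n, q ^ k :=
        Finset.sum_le_sum fun k _ => pow_le_pow_of_le_one hq.le hq1.le (Nat.le_add_left k j)
    _ ≤ ∑' k, q ^ k := (summable_geometric_of_lt_one hq.le hq1).sum_le_tsum _
        fun k _ => by positivity
    _ = _ := tsum_geometric_of_lt_one hq.le hq1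

theorem exists_variance_bound (hd : 1 ≤ d) {μ : Measure (S d)} [IsProbabilityMeasure μ]
    (h1 : P1 μ) (h3 : P3 μ) (h4 : P4 μ) (h5 : P5 μ) {Ω : Type*} [MeasurableSpace Ω]
    {Pr : Measure Ω} [IsProbabilityMeasure Pr] {g : ℕ → Ω → S d} (hg : IsIIDSeq g Pr μ) :
    ∃ σ : ℝ, 0 < σ ∧ ∃ C : ℝ, ∀ (x : limitedCone d) (m n : ℕ),
      |variance (blockSum g x (m + 1) n) Pr - n * σ ^ 2| ≤ C := by
  obtain ⟨C, q, hcon⟩ := exists_geomContract hd h3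
  obtain ⟨hC, hq, hq1, hdecay⟩ := id hcon
  obtain ⟨θ, B, hθ, hl, hB, heq⟩ := hcon.exists_poisson measurable_meanRho
    (projLip_meanRho hd h1) (hcon.abs_iterate_meanRho_le hd h1 h4)
  obtain ⟨K, hK⟩ := exists_projLip_meanSq hd h1 hθ hB hl
  have hsqm := measurable_meanSq (μ := μ) hθ
  obtain ⟨c, hc⟩ := hcon.exists_limit hd hsqm hK
  have hB' := hK.abs_le (barycentre hd)
  set A := ∫ s, (Real.log (N s) + 2 * B) ∂μ
  have hB0 : 0 ≤ B := hl.nonneg (barycentre hd)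
  have hK0 : 0 ≤ K := hK.nonneg (barycentre hd)
  have hA0 : 0 ≤ A := integral_nonneg fun s => by
    have := log_N_nonneg hd s
    simp only [Pi.zero_apply]
    positivity
  have hc0 : 0 < c := by
    obtain ⟨δ, hδ, hp⟩ := h5
    -- The block length `n` stays fixed, long enough to beat the coboundary; letting the start `j`
    -- tend to infinity gives `p ^ n ≤ n c`, where `p > 0` is the probability in P5.
    obtain ⟨n, hn⟩ := exists_nat_ge ((1 + 2 * B) / δ)
    rw [div_le_iff₀ hδ] at hn
    have hp' := ENNReal.toReal_pos hp.ne' (measure_ne_top _ _)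
    set b := barycentre hd
    have hlim : Tendsto (fun j => ∑ k ∈ Finset.range n, (transfer μ)^[j + k] (meanSq μ θ) b) atTop
        (𝓝 (∑ k ∈ Finset.range n, c)) := by
      refine tendsto_finsetSum _ fun k _ => ?_
      refine (tendsto_add_atTop_iff_nat (f := fun j => (transfer μ)^[j] (meanSq μ θ) b) k).2 ?_
      rw [tendsto_iff_dist_tendsto_zero]
      refine squeeze_zero (fun _ => dist_nonneg) (fun n => hc n b) ?_
      simpa using ((tendsto_pow_atTop_nhds_zero_of_lt_one hq.le hq1).const_mul C).mul_const K
    have h6 := ge_of_tendsto' hlim fun j => by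
      rw [← hg.integral_msum_sq hd h1 hθ hB heq j n hB']
      exact hg.pow_le_integral_msum_sq hd h1 hθ hB (x := b) (n := n) (δ := δ) (by linarith) j
    have h7 := (pow_pos hp' n).trans_le h6
    rw [Finset.sum_const, Finset.card_range, nsmul_eq_mul] at h7
    exact (pos_iff_pos_of_mul_pos h7).1 (lt_of_le_of_ne (Nat.cast_nonneg n) fun h => by
      rw [← h] at h7; simp at h7)
  -- The three terms bound `|Var M - n c|`, twice the covariance of `M` and `Y`, and `Var Y`.
  refine ⟨√c, Real.sqrt_pos.2 hc0,
    C * (1 - q)⁻¹ * K + 2 * (A * (C * (1 - q)⁻¹ * B)) + (2 * B) ^ 2, fun x m n => ?_⟩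
  rw [Real.sq_sqrt hc0.le]
  set M := msum g x θ m n
  set Y : Ω → ℝ := fun ω => θ (X g x m ω) - θ (X g x (m + n) ω)
  have mM : MemLp M 2 Pr := hg.memLp_msum hd h1 hθ hB m n
  have m1 := hg.memLp_comp_X (x := x) hθ hB m
  have m2 := hg.memLp_comp_X (x := x) hθ hB (m + n)
  have mY : MemLp Y 2 Pr := m1.sub m2
  have eS : blockSum g x (m + 1) n = M + Y := by
    ext ω
    rw [Pi.add_apply, blockSum_succ]
    simp only [M, Y, msum_eq]
    ring
  have eM : ∫ ω, M ω ∂Pr = 0 := hg.integral_msum hd h1 hθ hB heq m n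
  have vM : variance M Pr = ∑ k ∈ Finset.range n, (transfer μ)^[m + k] (meanSq μ θ) x := by
    rw [variance_of_integral_eq_zero mM.aemeasurable eM,
      ← hg.integral_msum_sq hd h1 hθ hB heq m n hB']
  have bM : |variance M Pr - n * c| ≤ C * (1 - q)⁻¹ * K := by
    have e : (n : ℝ) * c = ∑ k ∈ Finset.range n, c := by simp
    rw [vM, e, ← Finset.sum_sub_distrib]
    calc _ ≤ ∑ k ∈ Finset.range n, C * q ^ (m + k) * K :=
          (Finset.abs_sum_le_sum_abs _ _).trans (Finset.sum_le_sum fun k _ => hc (m + k) x)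
      _ = C * (∑ k ∈ Finset.range n, q ^ (m + k)) * K := by
          rw [Finset.mul_sum, Finset.sum_mul]
      _ ≤ _ := by gcongr; exact sum_geometric_le hq hq1 m n
  have bc : |covariance M Y Pr| ≤ A * (C * (1 - q)⁻¹ * B) := by
    rw [covariance_eq_sub mM mY, eM, zero_mul, sub_zero]
    -- Only the endpoint of the coboundary correlates with `M`: its starting value is known before
    -- the differences.
    have e : ∫ ω, (M * Y) ω ∂Pr = - ∫ ω, M ω * θ (X g x (m + n) ω) ∂Pr := by
      simp only [Pi.mul_apply, Y, mul_sub]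
      have i1 : Integrable (fun ω => M ω * θ (X g x m ω)) Pr := mM.integrable_mul m1
      have i2 : Integrable (fun ω => M ω * θ (X g x (m + n) ω)) Pr := mM.integrable_mul m2
      rw [integral_sub i1 i2,
        hg.integral_msum_mul_start hd h1 hθ hB heq m n hθ hB, zero_sub]
    rw [e, abs_neg]
    refine (hg.abs_integral_msum_mul_end_le hd h1 hθ hB heq m n hθ hB
      (b := fun i => C * q ^ i * B) fun i => (hdecay B θ hθ hl i).abs_sub_le).trans ?_
    rw [← Finset.sum_mul, ← Finset.mul_sum]
    have := sum_geometric_le hq hq1 0 n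
    simp only [zero_add] at this
    gcongr
  have vY : variance Y Pr ≤ (2 * B) ^ 2 := by
    refine (variance_le_expectation_sq mY.aestronglyMeasurable).trans ?_
    calc _ ≤ ∫ _, (2 * B) ^ 2 ∂Pr := by
          refine integral_mono mY.integrable_sq (integrable_const _) fun ω => ?_
          have h6 := abs_le.1 (hB (X g x m ω))
          have h7 := abs_le.1 (hB (X g x (m + n) ω))
          exact sq_le_sq' (by simp only [Y]; linarith) (by simp only [Y]; linarith)
      _ = _ := by simp
  have vY0 := variance_nonneg Y Pr
  rw [eS, variance_add mM mY]
  rw [abs_le] at *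
  constructor <;> linarith

end PosProd

end

theorem proposition5p3 {d : ℕ} (hd : 1 ≤ d)
    (μ : Measure (PosProd.S d)) [IsProbabilityMeasure μ]
    (h1 : PosProd.P1 μ) (h2 : PosProd.P2 μ) (h3 : PosProd.P3 μ) (h4 : PosProd.P4 μ)
    (h5 : PosProd.P5 μ)
    {Ω : Type*} [MeasurableSpace Ω] (Pr : Measure Ω) [IsProbabilityMeasure Pr]
    (g : ℕ → Ω → PosProd.S d) (hg_meas : ∀ n, Measurable (g n))
    (hg_indep : iIndepFun g Pr) (hg_law : ∀ n, Measure.map (g n) Pr = μ) :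
    ∃ σ : ℝ, 0 < σ ∧
      (∀ (x : PosProd.limitedCone d) (m n : ℕ), MemLp (PosProd.blockSum g x m n) 2 Pr) ∧
      (∃ C : ℝ, 0 < C ∧ ∀ γ : ℝ, 0 < γ → ∀ (x : PosProd.limitedCone d) (n : ℕ), 1 ≤ n → ∀ m : ℕ,
        |(n : ℝ)⁻¹ * variance (PosProd.blockSum g x m n) Pr - σ ^ 2| ≤ C * (n : ℝ) ^ (-1 + γ)) ∧
      (∃ C : ℝ, 0 < C ∧ ∀ (x : PosProd.limitedCone d) (n : ℕ), 1 ≤ n → ∀ m : ℕ,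
        |variance (PosProd.blockSum g x m n) Pr - n * σ ^ 2| ≤ C) := by
  have hg : PosProd.IsIIDSeq g Pr μ := ⟨hg_meas, hg_indep, hg_law⟩
  obtain ⟨σ, hσ, C, hC⟩ := PosProd.exists_variance_bound hd h1 h3 h4 h5 hg
  have hC0 : 0 ≤ C := (abs_nonneg _).trans (hC (PosProd.barycentre hd) 0 0)
  -- The extra `σ ^ 2` accounts for blocks starting at `0`, which have one effective increment
  -- fewer.
  have key : ∀ (x : PosProd.limitedCone d) (n : ℕ), 1 ≤ n → ∀ m : ℕ,
      |variance (PosProd.blockSum g x m n) Pr - n * σ ^ 2| ≤ C + σ ^ 2 := by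
    intro x n hn m
    have hσ2 := sq_nonneg σ
    cases m with
    | succ m => exact (hC x m n).trans (le_add_of_nonneg_right hσ2)
    | zero =>
      obtain ⟨n, rfl⟩ := Nat.exists_eq_add_of_le' hn
      have h := hC x 0 n
      rw [zero_add] at h
      rw [PosProd.blockSum_zero_succ]
      push_cast
      rw [abs_le] at *
      constructor <;> linarith
  have hpos : 0 < C + σ ^ 2 := by positivity
  refine ⟨σ, hσ, fun x m n => hg.memLp_blockSum hd h1 m n, ⟨C + σ ^ 2, hpos, ?_⟩,
    C + σ ^ 2, hpos, key⟩
  intro γ hγ x n hn m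
  have hn1 : (1 : ℝ) ≤ n := by exact_mod_cast hn
  have hn0 : (0 : ℝ) < n := by positivity
  have e : (n : ℝ)⁻¹ * variance (PosProd.blockSum g x m n) Pr - σ ^ 2 =
      (n : ℝ)⁻¹ * (variance (PosProd.blockSum g x m n) Pr - n * σ ^ 2) := by
    field_simp
  rw [e, abs_mul, abs_of_pos (inv_pos.2 hn0), mul_comm]
  refine mul_le_mul (key x n hn m) ?_ (inv_pos.2 hn0).le hpos.le
  -- As `n ≥ 1`, `n⁻¹ ≤ n ^ (-1 + γ)`, so one constant serves every `γ > 0`.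
  rw [← Real.rpow_neg_one]
  exact Real.rpow_le_rpow_of_exponent_le hn1 (by linarith)
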